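/- Let $\mathfrak a=\mathfrak o_{2n+1}$ ($n\ge 1$), $\mathfrak{sp}_{2n}$ ($n\ge 1$) or $\mathfrak o_{2n}$ ($n\ge 2$), and set $N=2n+1$, $2n$, $2n$, respectively. Let all indices run over $-n,\dots,n$, where the value $0$ is skipped if $N=2n$. Put $\kappa=N/2-1$ and $\theta_{ij}=1$ in the orthogonal case, and $\kappa=N/2+1$ and $\theta_{ij}=\operatorname{sgn} i\cdot\operatorname{sgn} j$ in the symplectic case. The extended Yangian $\mathrm X(\mathfrak a)$ is the unital associative algebra over $\mathbb C$ with generators $t_{ij}^{(r)}$, $r\ge 1$, and defining relations, for the series $t_{ij}(u)=\delta_{ij}+\sum_{r\ge 1}t_{ij}^{(r)}u^{-r}$, $$[t_{ij}(u),t_{kl}(v)]=\frac{1}{u-v}\bigl(t_{kj}(u)t_{il}(v)-t_{kj}(v)t_{il}(u)\bigr)-\frac{1}{u-v-\kappa}\Bigl(\delta_{k,-i}\sum_{p}\theta_{ip}\,t_{pj}(u)t_{-p,l}(v)-\delta_{l,-j}\sum_{p}\theta_{jp}\,t_{k,-p}(v)t_{ip}(u)\Bigr).$$ Let $\lambda(u)=(\lambda_{-n}(u),\dots,\lambda_n(u))$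 be any tuple of formal series $\lambda_i(u)\in 1+u^{-1}\mathbb C[[u^{-1}]]$. The Verma module $M(\lambda(u))$ is the quotient of $\mathrm X(\mathfrak a)$ by the left ideal generated by all the coefficients of the series $t_{ij}(u)$ with $i<j$ and of the series $t_{ii}(u)-\lambda_i(u)$ for all $i$. Then $M(\lambda(u))$ is nonzero if and only if $$\frac{\lambda_{-n+i-1}(u+\kappa-i)}{\lambda_{-n+i}(u+\kappa-i)}=\frac{\lambda_{n-i}(u)}{\lambda_{n-i+1}(u)}\qquad\text{in }\mathbb C[[u^{-1}]]$$ for $i=1,\dots,n-1$ if $\mathfrak a=\mathfrak o_{2n}$ or $\mathfrak{sp}_{2n}$, and for $i=1,\dots,n$ if $\mathfrak a=\mathfrak o_{2n+1}$. -/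

import Mathlib

namespace ExtYangian

/-- The three series of classical Lie algebras of rank `n`:
`B` is `o_{2n+1}`, `C` is `sp_{2n}` and `D` is `o_{2n}`. -/
inductive ClassicalSeries
  | B
  | C
  | D
  deriving DecidableEq

open ClassicalSeries

/-- The labels of rows and columns: `-n, …, -1, 0, 1, …, n` for `o_{2n+1}`, and
`-n, …, -1, 1, …, n` for `sp_{2n}` and `o_{2n}`. -/
noncomputable def indices (S : ClassicalSeries) (n : ℕ) : Finset ℤ :=
  if S = B then Finset.Icc (-(n : ℤ)) n else (Finset.Icc (-(n : ℤ)) n).erase 0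

/-- The labels as a (finite) type. -/
abbrev Idx (S : ClassicalSeries) (n : ℕ) : Type := {i : ℤ // i ∈ indices S n}

theorem neg_mem_indices {S : ClassicalSeries} {n : ℕ} {i : ℤ} (h : i ∈ indices S n) :
    -i ∈ indices S n := by
  unfold indices at *
  split_ifs at * <;> simp at * <;> omega

instance (S : ClassicalSeries) (n : ℕ) : Neg (Idx S n) :=
  ⟨fun i => ⟨-i.1, neg_mem_indices i.2⟩⟩

/-- `θ_{ij}`: equal to `1` in the orthogonal case and to `sgn i * sgn j` in the symplectic case. -/
def theta (S : ClassicalSeries) (i j : ℤ) : ℂ :=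
  match S with
  | B => 1
  | C => ((i.sign * j.sign : ℤ) : ℂ)
  | D => 1

/-- The size `N` of the matrices: `2n+1` or `2n`. -/
def matSize (S : ClassicalSeries) (n : ℕ) : ℕ :=
  match S with
  | B => 2 * n + 1
  | C => 2 * n
  | D => 2 * n

/-- `κ = N/2 - 1` in the orthogonal case and `κ = N/2 + 1` in the symplectic case. -/
noncomputable def kappa (S : ClassicalSeries) (n : ℕ) : ℂ :=
  match S with
  | B => (matSize B n : ℂ) / 2 - 1
  | C => (matSize C n : ℂ) / 2 + 1
  | D => (matSize D n : ℂ) / 2 - 1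

/-- The free associative algebra on the symbols `t_{ij}^{(r)}`, with `r ≥ 1`. -/
abbrev FreeGen (S : ClassicalSeries) (n : ℕ) : Type :=
  FreeAlgebra ℂ (Idx S n × Idx S n × ℕ+)

/-- The coefficient `t_{ij}^{(r)}` of `u^{-r}` in the series `t_{ij}(u)`, for every integer `r`:
the generator for `r ≥ 1`, `δ_{ij}` for `r = 0`, and `0` for `r < 0`. -/
noncomputable def tFree {S : ClassicalSeries} {n : ℕ} (i j : Idx S n) (r : ℤ) : FreeGen S n :=
  if h : 0 < r then FreeAlgebra.ι ℂ (i, j, ⟨r.toNat, by omega⟩)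
  else if r = 0 ∧ i = j then 1 else 0

section TwoVariableSeries

variable {A : Type*} [AddCommGroup A] [Module ℂ A]

/-- A formal series `∑ c r s u^{-r} v^{-s}` is given by its family of coefficients `c`.
This is its product with `u - v - a`. -/
def mulUSubVSub (a : ℂ) (c : ℤ → ℤ → A) : ℤ → ℤ → A :=
  fun r s => c (r + 1) s - c r (s + 1) - a • c r s

end TwoVariableSeries

section Relations

variable {S : ClassicalSeries} {n : ℕ}

/-- The coefficient of `u^{-r} v^{-s}` in the commutator `[t_{ij}(u), t_{kl}(v)]`. -/
noncomputable def commSeries (i j k l : Idx S n) : ℤ → ℤ → FreeGen S n :=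
  fun r s => tFree i j r * tFree k l s - tFree k l s * tFree i j r

/-- The coefficient of `u^{-r} v^{-s}` in `t_{kj}(u) t_{il}(v) - t_{kj}(v) t_{il}(u)`. -/
noncomputable def permSeries (i j k l : Idx S n) : ℤ → ℤ → FreeGen S n :=
  fun r s => tFree k j r * tFree i l s - tFree k j s * tFree i l r

/-- The coefficient of `u^{-r} v^{-s}` in
`δ_{k,-i} ∑_p θ_{ip} t_{pj}(u) t_{-p,l}(v) - δ_{l,-j} ∑_p θ_{jp} t_{k,-p}(v) t_{ip}(u)`. -/
noncomputable def transSeries (i j k l : Idx S n) : ℤ → ℤ → FreeGen S n :=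
  fun r s =>
    (if k = -i then ∑ p : Idx S n, theta S i p • (tFree p j r * tFree (-p) l s) else 0)
    - (if l = -j then ∑ p : Idx S n, theta S j p • (tFree k (-p) s * tFree i p r) else 0)

/-- The defining relations of the extended Yangian,
`[t_{ij}(u), t_{kl}(v)] = (u-v)⁻¹ (t_{kj}(u) t_{il}(v) - t_{kj}(v) t_{il}(u))`
`- (u-v-κ)⁻¹ (δ_{k,-i} ∑_p θ_{ip} t_{pj}(u) t_{-p,l}(v) - δ_{l,-j} ∑_p θ_{jp} t_{k,-p}(v) t_{ip}(u))`,
which are the matrix entries of `R(u-v) T₁(u) T₂(v) = T₂(v) T₁(u) R(u-v)` with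
`R(u) = 1 - P u⁻¹ + Q (u-κ)⁻¹`. Both sides are multiplied by `(u-v)(u-v-κ)`, and the coefficients
of all `u^{-r} v^{-s}` (`r`, `s` integers) are compared. -/
inductive Rel (S : ClassicalSeries) (n : ℕ) : FreeGen S n → FreeGen S n → Prop
  | rtt (i j k l : Idx S n) (r s : ℤ) :
      Rel S n
        (mulUSubVSub 0 (mulUSubVSub (kappa S n) (commSeries i j k l)) r s)
        (mulUSubVSub (kappa S n) (permSeries i j k l) r s
          - mulUSubVSub 0 (transSeries i j k l) r s)

end Relations

/-- The extended Yangian `X(𝔞)`, where `𝔞 = o_{2n+1}`, `sp_{2n}` or `o_{2n}`: the unital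
associative complex algebra with the above generators and relations. -/
abbrev X (S : ClassicalSeries) (n : ℕ) : Type := RingQuot (Rel S n)

/-- The element `t_{ij}^{(r)}` of the extended Yangian. -/
noncomputable def t {S : ClassicalSeries} {n : ℕ} (i j : Idx S n) (r : ℕ) : X S n :=
  RingQuot.mkAlgHom ℂ (Rel S n) (tFree i j (r : ℤ))

/-- The left ideal of `X(𝔞)` generated by all the coefficients of the series `t_{ij}(u)`, `i < j`,
and `t_{ii}(u) - λ_i(u)`. A series in `u⁻¹` is a power series in the variable `u⁻¹`; only the
components `lam i` with `i` in `indices S n` enter. -/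
noncomputable def vermaIdeal (S : ClassicalSeries) (n : ℕ) (lam : ℤ → PowerSeries ℂ) :
    Submodule (X S n) (X S n) :=
  Submodule.span (X S n)
    ({x | ∃ (i j : Idx S n) (r : ℕ), i.1 < j.1 ∧ x = t i j r} ∪
     {x | ∃ (i : Idx S n) (r : ℕ),
        x = t i i r - algebraMap ℂ (X S n) (PowerSeries.coeff r (lam i.1))})

/-- The Verma module `M(λ(u))` over `X(𝔞)`. -/
abbrev Verma (S : ClassicalSeries) (n : ℕ) (lam : ℤ → PowerSeries ℂ) : Type :=
  X S n ⧸ vermaIdeal S n lam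

/-- For `f = f(u)`, a power series in `x = u⁻¹`, this is `f(u + a)`, that is, the series obtained
by the substitution `x ↦ (u + a)⁻¹ = x (1 + a x)⁻¹`. -/
noncomputable def shift (a : ℂ) (f : PowerSeries ℂ) : PowerSeries ℂ :=
  PowerSeries.subst
    (PowerSeries.X * (1 + PowerSeries.C a * PowerSeries.X)⁻¹ : PowerSeries ℂ) f

/-- The number of conditions on the highest weight: `n` for `o_{2n+1}`, and `n - 1` for `sp_{2n}`
and `o_{2n}`. -/
def numConditions (S : ClassicalSeries) (n : ℕ) : ℕ :=
  match S with
  | B => n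
  | C => n - 1
  | D => n - 1

end ExtYangian

/-! The module is nonzero exactly when `1` lies outside the defining left ideal, that is, when some
linear functional `φ` on the extended Yangian vanishes on the ideal and has `φ 1 = 1`
(`isHighestWeight_iff`). Such functionals replace any knowledge of a basis of the algebra.

Necessity (`IsHighestWeight.shift_mul_eq`). Apply `φ` to the relations between `t_{pi}(u)` and
`t_{-p,-i}(v)` for `p < i ≤ 0`. The sums `Z_i = ∑_p θ_{ip} φ(t_{pi}(u) t_{-p,-i}(v))` and their
analogues `W_i` with the opposite order of factors satisfy a triangular linear system, which forces
`Z_i = W_i`. For consecutive labels `i < j ≤ 0` with `m` labels below `j` it gives `(u-v-κ+m)(Z_j -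
Z_i) = (u-v-κ)(λ_j(u)λ_{-j}(v) - λ_i(u)λ_{-i}(v))`. At `u = v+κ-m` the left side vanishes while
`u-v-κ = -m` does not, and the condition remains.

Sufficiency (`isHighestWeight_of_shift_mul_eq`). Highest weights are closed under products, through
the coproduct (`IsHighestWeight.mul`), under approximation in the `u⁻¹`-adic sense
(`IsHighestWeight.of_approx`) and under polynomial interpolation (`IsHighestWeight.of_forall_nat`).
Scalar matrices `f(u)·1` give the constant tuples. Fusion in tensor products of shifted vector
representations gives exterior powers (`Fused.succ`), and products and interpolation turn their
highest weights into tuples with any polynomial `f` in `u⁻¹` with `f(∞) = 1` at the `k` smallest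
labels, `f(u+κ-k)⁻¹` at the `k` largest and `1` elsewhere (`isHighestWeight_dualTuple`). A given
`λ(u)` is then approximated one coefficient at a time: by the necessary conditions, which hold both
for `λ` and for the current approximation, the error in the next coefficient is a constant plus a
function odd under `i ↦ -i`. The constant is corrected by a scalar tuple, the odd part by tuples of
the second kind. -/

namespace ExtYangian
open ClassicalSeries

/-! ### Formal series in `u⁻¹` and `v⁻¹`. -/

section Series

variable {A : Type*} [Ring A]

/-- A series in `u⁻¹`, viewed as a series in `u⁻¹` and `v⁻¹`. -/
noncomputable def serU : PowerSeries A →+* PowerSeries (PowerSeries A) :=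
  PowerSeries.map PowerSeries.C

/-- A series in `v⁻¹`, viewed as a series in `u⁻¹` and `v⁻¹`. -/
noncomputable def serV : PowerSeries A →+* PowerSeries (PowerSeries A) := PowerSeries.C

/-- The product `u⁻¹ v⁻¹`. -/
noncomputable def invUV : PowerSeries (PowerSeries A) :=
  PowerSeries.X * PowerSeries.C PowerSeries.X

/-- The coefficient of `u^{-r}`, for an integer `r`. -/
noncomputable def intCoeff (f : PowerSeries A) (r : ℤ) : A :=
  if 0 ≤ r then PowerSeries.coeff r.toNat f else 0

/-- The coefficient of `u^{-r} v^{-s}`, for integers `r` and `s`. -/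
noncomputable def intCoeff₂ (F : PowerSeries (PowerSeries A)) (r s : ℤ) : A :=
  intCoeff (intCoeff F r) s

@[simp] theorem intCoeff_natCast (f : PowerSeries A) (r : ℕ) :
    intCoeff f r = PowerSeries.coeff r f := by simp [intCoeff]

theorem intCoeff_of_neg (f : PowerSeries A) {r : ℤ} (h : r < 0) : intCoeff f r = 0 := by
  simp [intCoeff, h]

@[simp] theorem intCoeff_zero (r : ℤ) : intCoeff (0 : PowerSeries A) r = 0 := by simp [intCoeff]

theorem intCoeff_add (f g : PowerSeries A) (r : ℤ) :
    intCoeff (f + g) r = intCoeff f r + intCoeff g r := by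
  unfold intCoeff; split_ifs <;> simp

theorem intCoeff_sub (f g : PowerSeries A) (r : ℤ) :
    intCoeff (f - g) r = intCoeff f r - intCoeff g r := by
  unfold intCoeff; split_ifs <;> simp

theorem intCoeff_X_mul (f : PowerSeries A) (r : ℤ) :
    intCoeff (PowerSeries.X * f) (r + 1) = intCoeff f r := by
  rcases lt_trichotomy r (-1) with h | h | h
  · rw [intCoeff_of_neg _ (by omega), intCoeff_of_neg _ (by omega)]
  · subst h; simp [intCoeff]
  · lift r to ℕ using (by omega)
    have : ((r : ℤ) + 1) = ((r + 1 : ℕ) : ℤ) := by push_cast; rfl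
    rw [this, intCoeff_natCast, intCoeff_natCast, PowerSeries.coeff_succ_X_mul]

theorem intCoeff_C_mul (a : A) (f : PowerSeries A) (r : ℤ) :
    intCoeff (PowerSeries.C a * f) r = a * intCoeff f r := by
  unfold intCoeff; split_ifs <;> simp

theorem intCoeff₂_add (F G : PowerSeries (PowerSeries A)) (r s : ℤ) :
    intCoeff₂ (F + G) r s = intCoeff₂ F r s + intCoeff₂ G r s := by
  simp [intCoeff₂, intCoeff_add]

theorem intCoeff₂_sub (F G : PowerSeries (PowerSeries A)) (r s : ℤ) :
    intCoeff₂ (F - G) r s = intCoeff₂ F r s - intCoeff₂ G r s := by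
  simp [intCoeff₂, intCoeff_sub]

@[simp] theorem intCoeff₂_zero (r s : ℤ) :
    intCoeff₂ (0 : PowerSeries (PowerSeries A)) r s = 0 := by
  simp [intCoeff₂]

theorem intCoeff₂_sum {ι : Type*} (t : Finset ι) (F : ι → PowerSeries (PowerSeries A)) (r s : ℤ) :
    intCoeff₂ (∑ p ∈ t, F p) r s = ∑ p ∈ t, intCoeff₂ (F p) r s := by
  classical
  induction t using Finset.induction_on with
  | empty => simp
  | insert a t h ih => rw [Finset.sum_insert h, Finset.sum_insert h, intCoeff₂_add, ih]

/-- The offset by two absorbs the factor `u⁻² v⁻²` by which `linFactor a * linFactor b` differs from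
`(u-v-a)(u-v-b)`. Nothing is lost, as `r` and `s` run over all integers. -/
theorem intCoeff₂_ext {F G : PowerSeries (PowerSeries A)}
    (h : ∀ r s : ℤ, intCoeff₂ F (r + 1 + 1) (s + 1 + 1) = intCoeff₂ G (r + 1 + 1) (s + 1 + 1)) :
    F = G := by
  ext r s
  have := h (r - 1 - 1) (s - 1 - 1)
  simpa [intCoeff₂] using this

theorem intCoeff₂_X_mul (F : PowerSeries (PowerSeries A)) (r s : ℤ) :
    intCoeff₂ (PowerSeries.X * F) (r + 1) s = intCoeff₂ F r s := by
  rw [intCoeff₂, intCoeff_X_mul, intCoeff₂]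

theorem intCoeff₂_Y_mul (F : PowerSeries (PowerSeries A)) (r s : ℤ) :
    intCoeff₂ (PowerSeries.C PowerSeries.X * F) r (s + 1) = intCoeff₂ F r s := by
  rw [intCoeff₂, intCoeff_C_mul, intCoeff_X_mul, intCoeff₂]

theorem intCoeff₂_invUV_mul (F : PowerSeries (PowerSeries A)) (r s : ℤ) :
    intCoeff₂ (invUV * F) (r + 1) (s + 1) = intCoeff₂ F r s := by
  rw [invUV, mul_assoc, intCoeff₂_X_mul, intCoeff₂_Y_mul]

theorem intCoeff₂_serU_mul_serV (f g : PowerSeries A) (r s : ℤ) :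
    intCoeff₂ (serU f * serV g) r s = intCoeff f r * intCoeff g s := by
  unfold intCoeff₂ intCoeff serU serV
  split_ifs <;> simp

theorem intCoeff₂_serV_mul_serU (f g : PowerSeries A) (r s : ℤ) :
    intCoeff₂ (serV g * serU f) r s = intCoeff g s * intCoeff f r := by
  unfold intCoeff₂ intCoeff serU serV
  split_ifs <;> simp

theorem X_mul_serU_comm (F : PowerSeries (PowerSeries A)) :
    PowerSeries.C PowerSeries.X * F = F * PowerSeries.C PowerSeries.X := by
  ext1 r
  rw [PowerSeries.coeff_C_mul, PowerSeries.coeff_mul_C, PowerSeries.X_mul]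

theorem invUV_comm (F : PowerSeries (PowerSeries A)) : invUV * F = F * invUV :=
  Commute.mul_left (PowerSeries.commute_X F).symm (X_mul_serU_comm F)

variable [Algebra ℂ A]

/-- The product of `u - v - a` with `u⁻¹ v⁻¹`. -/
noncomputable def linFactor (a : ℂ) : PowerSeries (PowerSeries A) :=
  PowerSeries.C PowerSeries.X - PowerSeries.X - a • invUV

theorem linFactor_comm (a : ℂ) (F : PowerSeries (PowerSeries A)) :
    linFactor a * F = F * linFactor a := by
  simp only [linFactor, sub_mul, mul_sub, X_mul_serU_comm, PowerSeries.X_mul, smul_mul_assoc,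
    mul_smul_comm, invUV_comm]

theorem intCoeff₂_smul (a : ℂ) (F : PowerSeries (PowerSeries A)) (r s : ℤ) :
    intCoeff₂ (a • F) r s = a • intCoeff₂ F r s := by
  unfold intCoeff₂ intCoeff
  split_ifs <;> simp

theorem intCoeff₂_linFactor_mul (a : ℂ) (F : PowerSeries (PowerSeries A)) (r s : ℤ) :
    intCoeff₂ (linFactor a * F) (r + 1) (s + 1) = mulUSubVSub a (intCoeff₂ F) r s := by
  rw [linFactor, sub_mul, sub_mul, intCoeff₂_sub, intCoeff₂_sub, intCoeff₂_Y_mul, intCoeff₂_X_mul,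
    smul_mul_assoc, intCoeff₂_smul, intCoeff₂_invUV_mul, mulUSubVSub]

theorem intCoeff₂_linFactor_mul_linFactor_mul (a b : ℂ) (F : PowerSeries (PowerSeries A))
    (r s : ℤ) :
    intCoeff₂ (linFactor a * linFactor b * F) (r + 1 + 1) (s + 1 + 1) =
      mulUSubVSub a (mulUSubVSub b (intCoeff₂ F)) r s := by
  rw [mul_assoc, intCoeff₂_linFactor_mul, mulUSubVSub]
  simp only [intCoeff₂_linFactor_mul]
  rfl

end Series

/-! ### The defining relations as one identity of series, and the universal property. -/

section RTT

variable {S : ClassicalSeries} {n : ℕ}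

instance : InvolutiveNeg (Idx S n) where
  neg_neg i := Subtype.ext (neg_neg i.1)

@[simp] theorem coe_neg (i : Idx S n) : (↑(-i) : ℤ) = -(i : ℤ) := rfl

/-- The matrix entries of the relation `R(u - v) T₁(u) T₂(v) = T₂(v) T₁(u) R(u - v)` for
`R(u - v) = a - b P + c Q`. -/
def RTT {B : Type*} [Ring B] [Algebra ℂ B] (a b c : B) (T T' : Matrix (Idx S n) (Idx S n) B) :
    Prop :=
  ∀ i j k l : Idx S n, a * (T i j * T' k l - T' k l * T i j) =
    b * (T k j * T' i l - T' k j * T i l) -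
    c * ((if k = -i then ∑ p : Idx S n, theta S i p • (T p j * T' (-p) l) else 0)
    - (if l = -j then ∑ p : Idx S n, theta S j p • (T' k (-p) * T i p) else 0))

/-- A matrix of series which satisfies the defining relations of the extended Yangian. -/
structure IsRTT {A : Type*} [Ring A] [Algebra ℂ A]
    (T : Matrix (Idx S n) (Idx S n) (PowerSeries A)) : Prop where
  coeff_zero : ∀ i j, PowerSeries.coeff 0 (T i j) = if i = j then 1 else 0
  rtt : RTT (S := S) (n := n) (linFactor 0 * linFactor (kappa S n))
    (invUV * linFactor (kappa S n)) (invUV * linFactor 0) (T.map serU) (T.map serV)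

variable {A : Type*} [Ring A] [Algebra ℂ A]

/-- Both sides of the relations, multiplied by `u⁻² v⁻²`, become honest power series in `u⁻¹` and
`v⁻¹`; comparing their coefficients gives the relations back. -/
theorem RTT_iff (T : Matrix (Idx S n) (Idx S n) (PowerSeries A))
    (f : FreeGen S n →ₐ[ℂ] A) (hf : ∀ i j r, f (tFree i j r) = intCoeff (T i j) r) :
    RTT (S := S) (n := n) (linFactor 0 * linFactor (kappa S n))
    (invUV * linFactor (kappa S n)) (invUV * linFactor 0) (T.map serU) (T.map serV) ↔
    ∀ x y, Rel S n x y → f x = f y := by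
  have key : ∀ i j k l r s,
      (intCoeff₂ (linFactor 0 * linFactor (kappa S n) *
        (T.map serU i j * T.map serV k l - T.map serV k l * T.map serU i j)) (r + 1 + 1) (s + 1 + 1)
      = f (mulUSubVSub 0 (mulUSubVSub (kappa S n) (commSeries i j k l)) r s)) ∧
      (intCoeff₂ ((invUV * linFactor (kappa S n)) *
          (T.map serU k j * T.map serV i l - T.map serV k j * T.map serU i l) -
        (invUV * linFactor 0) *
          ((if k = -i then ∑ p : Idx S n, theta S i p • (T.map serU p j * T.map serV (-p) l) else 0)
          - (if l = -j then ∑ p : Idx S n, theta S j p • (T.map serV k (-p) * T.map serU i p)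
              else 0))) (r + 1 + 1) (s + 1 + 1) =
       f (mulUSubVSub (kappa S n) (permSeries i j k l) r s
          - mulUSubVSub 0 (transSeries i j k l) r s)) := by
    intro i j k l r s
    have h1 : ∀ c : ℤ → ℤ → FreeGen S n, ∀ a r s, f (mulUSubVSub a c r s) =
        mulUSubVSub a (fun r s => f (c r s)) r s := by
      intro c a r s; simp [mulUSubVSub]
    constructor
    · rw [intCoeff₂_linFactor_mul_linFactor_mul, h1]
      congr 1
      funext r s
      rw [h1]
      congr 1
      funext r s
      simp only [commSeries, map_sub, map_mul, hf, intCoeff₂_sub, Matrix.map_apply,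
        intCoeff₂_serU_mul_serV, intCoeff₂_serV_mul_serU]
    · rw [map_sub, intCoeff₂_sub, mul_assoc, mul_assoc, intCoeff₂_invUV_mul, intCoeff₂_invUV_mul,
        intCoeff₂_linFactor_mul, intCoeff₂_linFactor_mul, h1, h1]
      congr 2
      · funext r s
        simp only [permSeries, map_sub, map_mul, hf, intCoeff₂_sub, Matrix.map_apply,
          intCoeff₂_serU_mul_serV, intCoeff₂_serV_mul_serU]
      · funext r s
        simp only [transSeries, map_sub, intCoeff₂_sub]
        congr 1
        · split_ifs
          · simp [intCoeff₂_sum, intCoeff₂_smul, intCoeff₂_serU_mul_serV, hf]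
          · simp
        · split_ifs
          · simp [intCoeff₂_sum, intCoeff₂_smul, intCoeff₂_serV_mul_serU, hf]
          · simp
  constructor
  · rintro h x y ⟨i, j, k, l, r, s⟩
    rw [← (key i j k l r s).1, ← (key i j k l r s).2, h]
  · intro h i j k l
    apply intCoeff₂_ext
    intro r s
    rw [(key i j k l r s).1, (key i j k l r s).2]
    exact h _ _ (Rel.rtt i j k l r s)

theorem tFree_of_pos (i j : Idx S n) (r : ℕ) :
    tFree i j ((r : ℤ) + 1) = FreeAlgebra.ι ℂ (i, j, ⟨r + 1, r.succ_pos⟩) := by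
  unfold tFree
  rw [dif_pos (by omega)]
  rfl

theorem tFree_of_neg (i j : Idx S n) {r : ℤ} (h : r < 0) : tFree i j r = 0 := by
  unfold tFree
  rw [dif_neg (by omega), if_neg (by omega)]

theorem tFree_zero (i j : Idx S n) : tFree i j 0 = if i = j then 1 else 0 := by
  unfold tFree
  rw [dif_neg (by omega)]
  simp

/-- The matrix of generating series of the extended Yangian. -/
noncomputable def tMat (S : ClassicalSeries) (n : ℕ) :
    Matrix (Idx S n) (Idx S n) (PowerSeries (X S n)) :=
  Matrix.of fun i j => PowerSeries.mk fun r => t i j r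

@[simp] theorem coeff_tMat (i j : Idx S n) (r : ℕ) :
    PowerSeries.coeff r (tMat S n i j) = t i j r := by simp [tMat]

theorem t_zero (i j : Idx S n) : t i j 0 = if i = j then 1 else 0 := by
  rw [t, Nat.cast_zero, tFree_zero]
  split_ifs <;> simp

theorem tMat_isRTT (S : ClassicalSeries) (n : ℕ) : IsRTT (tMat S n) where
  coeff_zero i j := by rw [coeff_tMat, t_zero]
  rtt := by
    rw [RTT_iff (tMat S n) (RingQuot.mkAlgHom ℂ (Rel S n))]
    · exact fun x y h => RingQuot.mkAlgHom_rel ℂ h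
    · intro i j r
      rcases lt_or_ge r 0 with h | h
      · rw [tFree_of_neg i j h, intCoeff_of_neg _ h, map_zero]
      · lift r to ℕ using h
        rw [intCoeff_natCast, coeff_tMat, t]

theorem IsRTT.exists_lift {T : Matrix (Idx S n) (Idx S n) (PowerSeries A)} (hT : IsRTT T) :
    ∃ f : X S n →ₐ[ℂ] A, ∀ i j r, f (t i j r) = PowerSeries.coeff r (T i j) := by
  let g : FreeGen S n →ₐ[ℂ] A :=
    FreeAlgebra.lift ℂ fun p => PowerSeries.coeff (p.2.2 : ℕ) (T p.1 p.2.1)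
  have hg : ∀ i j r, g (tFree i j r) = intCoeff (T i j) r := by
    intro i j r
    rcases lt_or_ge r 0 with h | h
    · rw [tFree_of_neg i j h, intCoeff_of_neg _ h, map_zero]
    · lift r to ℕ using h
      rw [intCoeff_natCast]
      rcases r with _ | r
      · rw [Nat.cast_zero, tFree_zero, hT.coeff_zero]
        split_ifs <;> simp
      · push_cast
        rw [tFree_of_pos]
        simp [g]
  refine ⟨RingQuot.liftAlgHom ℂ ⟨g, (RTT_iff T g hg).1 hT.rtt⟩, fun i j r => ?_⟩
  rw [t, RingQuot.liftAlgHom_mkAlgHom_apply, hg, intCoeff_natCast]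

theorem IsRTT.map {A' : Type*} [Ring A'] [Algebra ℂ A']
    (f : X S n →ₐ[ℂ] A') : IsRTT ((tMat S n).map (PowerSeries.map (f : X S n →+* A'))) where
  coeff_zero i j := by
    rw [Matrix.map_apply, PowerSeries.coeff_map, coeff_tMat, t_zero]
    split_ifs <;> simp
  rtt := by
    rw [RTT_iff _ (f.comp (RingQuot.mkAlgHom ℂ (Rel S n)))]
    · exact fun x y h => congrArg f (RingQuot.mkAlgHom_rel ℂ h)
    · intro i j r
      rcases lt_or_ge r 0 with h | h
      · rw [tFree_of_neg i j h, intCoeff_of_neg _ h, map_zero]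
      · lift r to ℕ using h
        rw [intCoeff_natCast, Matrix.map_apply, PowerSeries.coeff_map, coeff_tMat, t]
        rfl

end RTT

/-! ### Products of solutions of the RTT relation; the coproduct. -/

section Product

variable {S : ClassicalSeries} {n : ℕ} {B : Type*} [Ring B]

/-- The action of a matrix in the first tensor factor. -/
def inFirst (T : Matrix (Idx S n) (Idx S n) B) :
    Matrix (Idx S n × Idx S n) (Idx S n × Idx S n) B :=
  Matrix.of fun p q => if p.2 = q.2 then T p.1 q.1 else 0

/-- The action of a matrix in the second tensor factor. -/
def inSecond (T : Matrix (Idx S n) (Idx S n) B) :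
    Matrix (Idx S n × Idx S n) (Idx S n × Idx S n) B :=
  Matrix.of fun p q => if p.1 = q.1 then T p.2 q.2 else 0

theorem inFirst_mul_inSecond (T T' : Matrix (Idx S n) (Idx S n) B) :
    inFirst T * inSecond T' = Matrix.of fun p q => T p.1 q.1 * T' p.2 q.2 := by
  ext ⟨i, k⟩ ⟨j, l⟩
  simp [inFirst, inSecond, Matrix.mul_apply, Fintype.sum_prod_type]

theorem inSecond_mul_inFirst (T T' : Matrix (Idx S n) (Idx S n) B) :
    inSecond T' * inFirst T = Matrix.of fun p q => T' p.2 q.2 * T p.1 q.1 := by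
  ext ⟨i, k⟩ ⟨j, l⟩
  simp [inFirst, inSecond, Matrix.mul_apply, Fintype.sum_prod_type]

theorem inFirst_mul (T T' : Matrix (Idx S n) (Idx S n) B) :
    inFirst (T * T') = inFirst T * inFirst T' := by
  ext ⟨i, k⟩ ⟨j, l⟩
  by_cases h : k = l <;> simp [inFirst, Matrix.mul_apply, Fintype.sum_prod_type, h]

theorem inSecond_mul (T T' : Matrix (Idx S n) (Idx S n) B) :
    inSecond (T * T') = inSecond T * inSecond T' := by
  ext ⟨i, k⟩ ⟨j, l⟩
  by_cases h : i = j <;> simp [inSecond, Matrix.mul_apply, Fintype.sum_prod_type, h]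

theorem inFirst_mul_inSecond_comm {T T' : Matrix (Idx S n) (Idx S n) B}
    (h : ∀ i j k l, Commute (T i j) (T' k l)) :
    inFirst T * inSecond T' = inSecond T' * inFirst T := by
  rw [inFirst_mul_inSecond, inSecond_mul_inFirst]
  ext p q
  exact h _ _ _ _

theorem theta_comm (i j : ℤ) : theta S i j = theta S j i := by
  cases S <;> simp [theta, mul_comm]

variable [Algebra ℂ B]

/-- The matrix `a - b P + c Q`. -/
noncomputable def rMat (S : ClassicalSeries) (n : ℕ) (a b c : B) :
    Matrix (Idx S n × Idx S n) (Idx S n × Idx S n) B :=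
  Matrix.of fun p q => (if p.1 = q.1 ∧ p.2 = q.2 then a else 0)
    - (if p.1 = q.2 ∧ p.2 = q.1 then b else 0)
    + (if p.2 = -p.1 ∧ q.2 = -q.1 then theta S p.1 q.1 • c else 0)

/-- In the form `R T₁ T'₂ = T'₂ T₁ R` the relation is visibly multiplicative. The scalars `a`, `b`,
`c` must be central, since `R` stands on both sides of the entries of `T` and `T'`. -/
theorem rtt_iff_matrix {a b c : B} (ha : ∀ x, a * x = x * a) (hb : ∀ x, b * x = x * b)
    (hc : ∀ x, c * x = x * c) (T T' : Matrix (Idx S n) (Idx S n) B) :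
    RTT a b c T T' ↔
      rMat S n a b c * (inFirst T * inSecond T') = (inSecond T' * inFirst T) * rMat S n a b c := by
  have key : ∀ i j k l : Idx S n,
      (rMat S n a b c * (inFirst T * inSecond T')) (i, k) (j, l) =
        a * (T i j * T' k l) - b * (T k j * T' i l) +
        c * (if k = -i then ∑ p : Idx S n, theta S i p • (T p j * T' (-p) l) else 0) ∧
      ((inSecond T' * inFirst T) * rMat S n a b c) (i, k) (j, l) =
        a * (T' k l * T i j) - b * (T' k j * T i l) +
        c * (if l = -j then ∑ p : Idx S n, theta S j p • (T' k (-p) * T i p) else 0) := by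
    intro i j k l
    rw [inFirst_mul_inSecond, inSecond_mul_inFirst]
    constructor
    · rw [Matrix.mul_apply]
      simp only [rMat, Matrix.of_apply, add_mul, sub_mul, Finset.sum_add_distrib,
        Finset.sum_sub_distrib, Fintype.sum_prod_type, ite_and, ite_mul, zero_mul]
      congr 1
      · simp
      · by_cases h : k = -i
        · simp [h, Finset.mul_sum]
        · simp [h]
    · rw [Matrix.mul_apply]
      simp only [rMat, Matrix.of_apply, mul_add, mul_sub, Finset.sum_add_distrib,
        Finset.sum_sub_distrib, Fintype.sum_prod_type, ite_and, mul_ite, mul_zero]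
      congr 1
      · simp [ha, hb]
      · by_cases h : l = -j
        · simp [h, Finset.sum_mul, hc, theta_comm (j : ℤ)]
        · simp [h]
  have aux : ∀ p q r s y z : B, p - r + y = q - s + z ↔ p - q = r - s - (y - z) := by
    intro p q r s y z
    constructor <;> intro h <;> rw [← sub_eq_zero] at h ⊢ <;> rw [← h] <;> abel
  constructor
  · intro h
    ext ⟨i, k⟩ ⟨j, l⟩
    rw [(key i j k l).1, (key i j k l).2]
    have := h i j k l
    simp only [mul_sub] at this
    exact (aux _ _ _ _ _ _).2 this
  · intro h i j k l
    have := congrFun (congrFun h (i, k)) (j, l)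
    rw [(key i j k l).1, (key i j k l).2] at this
    simp only [mul_sub]
    exact (aux _ _ _ _ _ _).1 this

theorem RTT.mul {a b c : B} (ha : ∀ x, a * x = x * a) (hb : ∀ x, b * x = x * b)
    (hc : ∀ x, c * x = x * c) {T T' U U' : Matrix (Idx S n) (Idx S n) B}
    (hT : RTT a b c T T') (hU : RTT a b c U U')
    (h1 : ∀ i j k l, Commute (U i j) (T' k l)) (h2 : ∀ i j k l, Commute (T i j) (U' k l)) :
    RTT a b c (T * U) (T' * U') := by
  rw [rtt_iff_matrix ha hb hc] at *
  rw [inFirst_mul, inSecond_mul]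
  calc rMat S n a b c * (inFirst T * inFirst U * (inSecond T' * inSecond U'))
      = rMat S n a b c * (inFirst T * (inFirst U * inSecond T') * inSecond U') := by
        simp only [mul_assoc]
    _ = (rMat S n a b c * (inFirst T * inSecond T')) * (inFirst U * inSecond U') := by
        rw [inFirst_mul_inSecond_comm h1]; simp only [mul_assoc]
    _ = inSecond T' * inFirst T * (rMat S n a b c * (inFirst U * inSecond U')) := by
        rw [hT]; simp only [mul_assoc]
    _ = inSecond T' * (inFirst T * inSecond U') * inFirst U * rMat S n a b c := by
        rw [hU]; simp only [mul_assoc]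
    _ = _ := by rw [inFirst_mul_inSecond_comm h2]; simp only [mul_assoc]

theorem IsRTT.mul {A : Type*} [Ring A] [Algebra ℂ A]
    {T U : Matrix (Idx S n) (Idx S n) (PowerSeries A)} (hT : IsRTT T) (hU : IsRTT U)
    (h : ∀ i j r k l s, Commute (PowerSeries.coeff r (T i j)) (PowerSeries.coeff s (U k l))) :
    IsRTT (T * U) where
  coeff_zero i j := by
    have := hT.coeff_zero
    have := hU.coeff_zero
    simp_all [Matrix.mul_apply]
  rtt := by
    have hTU : ∀ i j k l, Commute (serU (U i j)) (serV (T k l)) := by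
      intro i j k l
      ext r s
      simp [serU, serV, (h k l s i j r).eq]
    have hUT : ∀ i j k l, Commute (serU (T i j)) (serV (U k l)) := by
      intro i j k l
      ext r s
      simp [serU, serV, (h i j r k l s).eq]
    have e1 : (T * U).map (serU (A := A)) = T.map serU * U.map serU := Matrix.map_mul
    have e2 : (T * U).map (serV (A := A)) = T.map serV * U.map serV := Matrix.map_mul
    rw [e1, e2]
    have hl := linFactor_comm (A := A)
    have hi := invUV_comm (A := A)
    refine RTT.mul ?_ ?_ ?_ hT.rtt hU.rtt hTU hUT
    · exact fun x => Commute.mul_left (hl _ x) (hl _ x)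
    · exact fun x => Commute.mul_left (hi x) (hl _ x)
    · exact fun x => Commute.mul_left (hi x) (hl _ x)

/-- This serves as the coproduct `t_{ij}(u) ↦ ∑_l t_{il}(u) ⊗ t_{lj}(u)` composed with `f` and `g`.
It is used both for `X ⊗ X` and for operators on a tensor product of two modules. -/
theorem exists_algHom_mul {A : Type*} [Ring A] [Algebra ℂ A] (f g : X S n →ₐ[ℂ] A)
    (h : ∀ x y, Commute (f x) (g y)) :
    ∃ F : X S n →ₐ[ℂ] A, ∀ i j r,
      F (t i j r) = ∑ l, ∑ p ∈ Finset.HasAntidiagonal.antidiagonal r, f (t i l p.1) * g (t l j p.2) := by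
  obtain ⟨F, hF⟩ := ((IsRTT.map f).mul (IsRTT.map g) (by
    intro i j r k l s
    simpa using h _ _)).exists_lift
  refine ⟨F, fun i j r => ?_⟩
  rw [hF, Matrix.mul_apply, map_sum]
  simp [PowerSeries.coeff_mul]

end Product

end ExtYangian

/-! ### Highest weight functionals and the operations on highest weights. -/

namespace ExtYangian
open ClassicalSeries

variable {S : ClassicalSeries} {n : ℕ}

/-- A functional which vanishes on the left ideal defining the Verma module `M(λ(u))` and takes the
value `1` at `1`. -/
structure IsHighestWeightFunctional (lam : ℤ → PowerSeries ℂ) (φ : X S n →ₗ[ℂ] ℂ) : Prop where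
  map_one : φ 1 = 1
  map_mul_raising : ∀ x (i j : Idx S n) r, i.1 < j.1 → φ (x * t i j r) = 0
  map_mul_diag : ∀ x (i : Idx S n) r, φ (x * t i i r) = PowerSeries.coeff r (lam i.1) * φ x

/-- The tuples `λ(u)` for which there is such a functional. -/
def IsHighestWeight (S : ClassicalSeries) (n : ℕ) (lam : ℤ → PowerSeries ℂ) : Prop :=
  ∃ φ : X S n →ₗ[ℂ] ℂ, IsHighestWeightFunctional lam φ

theorem nontrivial_verma_iff (lam : ℤ → PowerSeries ℂ) :
    Nontrivial (Verma S n lam) ↔ (1 : X S n) ∉ vermaIdeal S n lam := by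
  rw [Verma, Submodule.Quotient.nontrivial_iff, ne_eq, not_iff_not]
  constructor
  · intro h; rw [h]; trivial
  · intro h
    rw [eq_top_iff]
    intro x _
    simpa using (vermaIdeal S n lam).smul_mem x h

theorem IsHighestWeightFunctional.map_eq_zero {lam : ℤ → PowerSeries ℂ} {φ : X S n →ₗ[ℂ] ℂ}
    (h : IsHighestWeightFunctional lam φ) {x : X S n} (hx : x ∈ vermaIdeal S n lam) : φ x = 0 := by
  suffices H : ∀ y, φ (y * x) = 0 by simpa using H 1
  induction hx using Submodule.span_induction with
  | mem x hx =>
    intro y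
    rcases hx with ⟨i, j, r, hij, rfl⟩ | ⟨i, r, rfl⟩
    · exact h.map_mul_raising y i j r hij
    · rw [mul_sub, map_sub, h.map_mul_diag, ← Algebra.commutes, ← Algebra.smul_def, map_smul,
        smul_eq_mul, sub_self]
  | zero => simp
  | add a b _ _ ha hb => intro y; rw [mul_add, map_add, ha, hb, add_zero]
  | smul a b _ hb => intro y; rw [smul_eq_mul, ← mul_assoc, hb]

/-- Over a field, a vector outside a subspace is separated from it by a functional; the left ideal
is used here only as a complex subspace. -/
theorem isHighestWeight_iff (lam : ℤ → PowerSeries ℂ) :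
    IsHighestWeight S n lam ↔ Nontrivial (Verma S n lam) := by
  rw [nontrivial_verma_iff]
  constructor
  · rintro ⟨φ, h⟩ h1
    exact one_ne_zero (h.map_one.symm.trans (h.map_eq_zero h1))
  · intro h
    obtain ⟨f, hf, hle⟩ := Submodule.exists_le_ker_of_notMem
      (p := (vermaIdeal S n lam).restrictScalars ℂ) (v := (1 : X S n)) (by simpa using h)
    have hker : ∀ x ∈ vermaIdeal S n lam, f x = 0 := fun x hx => hle (by simpa using hx)
    refine ⟨(f 1)⁻¹ • f, ⟨by simp [hf], ?_, ?_⟩⟩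
    · intro x i j r hij
      have := hker _ ((vermaIdeal S n lam).smul_mem x
        (Submodule.subset_span (Or.inl ⟨i, j, r, hij, rfl⟩)))
      simpa [hf] using this
    · intro x i r
      have := hker _ ((vermaIdeal S n lam).smul_mem x
        (Submodule.subset_span (Or.inr ⟨i, r, rfl⟩)))
      rw [smul_eq_mul, mul_sub, map_sub, ← Algebra.commutes, ← Algebra.smul_def, map_smul,
        smul_eq_mul, sub_eq_zero] at this
      simp only [LinearMap.smul_apply, smul_eq_mul, this]
      ring

theorem IsHighestWeight.of_module {W : Type*} [AddCommGroup W] [Module ℂ W]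
    {lam : ℤ → PowerSeries ℂ}
    (ρ : X S n →ₐ[ℂ] Module.End ℂ W) (w : W) (hw : w ≠ 0)
    (h1 : ∀ (i j : Idx S n) r, i.1 < j.1 → ρ (t i j r) w = 0)
    (h2 : ∀ (i : Idx S n) r, ρ (t i i r) w = PowerSeries.coeff r (lam i.1) • w) :
    IsHighestWeight S n lam := by
  obtain ⟨f, hf, -⟩ := Submodule.exists_le_ker_of_notMem (p := (⊥ : Submodule ℂ W)) (v := w)
    (by simpa using hw)
  refine ⟨(f w)⁻¹ • f ∘ₗ (LinearMap.applyₗ w) ∘ₗ ρ.toLinearMap, ?_, ?_, ?_⟩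
  · simp [hf]
  · intro x i j r hij
    simp [h1 i j r hij]
  · intro x i r
    simp [h2]
    ring

/-- The functional is `φ ⊗ ψ` after the coproduct. For `i ≤ j`, a term `t_{il} ⊗ t_{lj}` with `l ≠
i` has a raising factor: the left one if `i < l`, the right one if `l < i`. Only `l = i`
contributes. -/
theorem IsHighestWeight.mul {lam mu : ℤ → PowerSeries ℂ} (hl : IsHighestWeight S n lam)
    (hm : IsHighestWeight S n mu) : IsHighestWeight S n (lam * mu) := by
  obtain ⟨φ, hφ⟩ := hl
  obtain ⟨ψ, hψ⟩ := hm
  obtain ⟨F, hF⟩ := exists_algHom_mul (S := S) (n := n) (A := TensorProduct ℂ (X S n) (X S n))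
    (Algebra.TensorProduct.includeLeft (R := ℂ) (S := ℂ) (A := X S n) (B := X S n))
    Algebra.TensorProduct.includeRight (fun x y => by simp [Commute, SemiconjBy])
  let Φ : TensorProduct ℂ (X S n) (X S n) →ₗ[ℂ] ℂ :=
    (TensorProduct.lid ℂ ℂ).toLinearMap ∘ₗ TensorProduct.map φ ψ
  have hΦ : ∀ x y, Φ (TensorProduct.tmul ℂ x y) = φ x * ψ y := fun x y => by simp [Φ]
  have key : ∀ (z : TensorProduct ℂ (X S n) (X S n)) (i j : Idx S n) r, i.1 ≤ j.1 →
      Φ (z * F (t i j r)) =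
        if i = j then PowerSeries.coeff r (lam i.1 * mu i.1) * Φ z else 0 := by
    intro z i j r hij
    induction z using TensorProduct.induction_on with
    | zero => simp
    | add x y hx hy => rw [add_mul, map_add, hx, hy]; split_ifs <;> simp [mul_add]
    | tmul x y =>
      simp only [hF, Finset.mul_sum, map_sum, Algebra.TensorProduct.includeLeft_apply,
        Algebra.TensorProduct.includeRight_apply, Algebra.TensorProduct.tmul_mul_tmul, one_mul,
        mul_one, hΦ]
      rw [Finset.sum_eq_single i]
      · split_ifs with h
        · subst h
          rw [PowerSeries.coeff_mul, Finset.sum_mul]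
          refine Finset.sum_congr rfl fun p _ => ?_
          rw [hφ.map_mul_diag, hψ.map_mul_diag]
          ring
        · refine Finset.sum_eq_zero fun p _ => ?_
          rw [hψ.map_mul_raising _ _ _ _ (lt_of_le_of_ne hij fun e => h (Subtype.ext e)), mul_zero]
      · intro l _ hl
        refine Finset.sum_eq_zero fun p _ => ?_
        rcases lt_or_gt_of_ne (fun e => hl (Subtype.ext e) : l.1 ≠ i.1) with h | h
        · rw [hψ.map_mul_raising _ _ _ _ (h.trans_le hij), mul_zero]
        · rw [hφ.map_mul_raising _ _ _ _ h, zero_mul]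
      · simp
  refine ⟨Φ ∘ₗ F.toLinearMap, ?_, ?_, ?_⟩
  · simp [Algebra.TensorProduct.one_def, hΦ, hφ.map_one, hψ.map_one]
  · intro x i j r hij
    simp only [LinearMap.comp_apply, AlgHom.toLinearMap_apply, map_mul]
    rw [key _ _ _ _ hij.le, if_neg (by rintro rfl; exact lt_irrefl _ hij)]
  · intro x i r
    simp only [LinearMap.comp_apply, AlgHom.toLinearMap_apply, map_mul]
    rw [key _ _ _ _ le_rfl, if_pos rfl, Pi.mul_apply]

theorem theta_neg_left (i p : ℤ) : theta S (-i) p = theta S i (-p) := by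
  cases S <;> simp [theta]

theorem exists_scalar_algHom (S : ClassicalSeries) (n : ℕ) (f : PowerSeries ℂ)
    (hf : PowerSeries.constantCoeff f = 1) : ∃ ρ : X S n →ₐ[ℂ] ℂ, ∀ i j r,
      ρ (t i j r) = if i = j then PowerSeries.coeff r f else 0 := by
  have hT : IsRTT (S := S) (n := n) (Matrix.of fun i j => if i = j then f else 0) := by
    constructor
    · intro i j
      have : PowerSeries.coeff 0 f = 1 := by simpa using hf
      simp only [Matrix.of_apply]
      split_ifs <;> simp [this]
    · intro i j k l
      have h1 : ∀ i j : Idx S n, Matrix.map (Matrix.of fun i j => if i = j then f else 0)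
          (serU (A := ℂ)) i j = if i = j then serU f else 0 := by
        intro i j; simp only [Matrix.map_apply, Matrix.of_apply]; split_ifs <;> simp
      have h2 : ∀ i j : Idx S n, Matrix.map (Matrix.of fun i j => if i = j then f else 0)
          (serV (A := ℂ)) i j = if i = j then serV f else 0 := by
        intro i j; simp only [Matrix.map_apply, Matrix.of_apply]; split_ifs <;> simp
      simp only [h1, h2, ite_mul, mul_ite, zero_mul, mul_zero, smul_ite, smul_zero,
        Finset.sum_ite_eq, Finset.mem_univ, if_true]
      have e : ∀ p : Idx S n, -p = l ↔ p = -l := fun p =>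
        ⟨fun h => by rw [← h, neg_neg], fun h => by rw [h, neg_neg]⟩
      have e' : -l = j ↔ l = -j := ⟨fun h => by rw [← h, neg_neg], fun h => by rw [h, neg_neg]⟩
      simp only [mul_comm (serV f), e, Finset.sum_ite_eq', Finset.mem_univ, if_true, e']
      have h0 : ∀ (p q : Prop) [Decidable p] [Decidable q] (y : PowerSeries (PowerSeries ℂ)),
          ((if p then if q then y else 0 else 0) - if q then if p then y else 0 else 0) = 0 := by
        intro p q _ _ y
        by_cases hp : p <;> by_cases hq : q <;> simp [hp, hq]
      have h0' : ((if k = -i then if l = -j then theta S i (-l : Idx S n) • (serU f * serV f) else 0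
          else 0) - if l = -j then if k = -i then theta S j i • (serU f * serV f) else 0 else 0) =
          0 := by
        by_cases hk : k = -i <;> by_cases hl : l = -j <;> simp [hk, hl, theta_comm (j : ℤ)]
      rw [h0, h0', sub_self]
      simp
  obtain ⟨ρ, hρ⟩ := hT.exists_lift
  refine ⟨ρ, fun i j r => ?_⟩
  rw [hρ, Matrix.of_apply]
  split_ifs <;> simp

theorem isHighestWeight_scalar (S : ClassicalSeries) (n : ℕ) (f : PowerSeries ℂ)
    (hf : PowerSeries.constantCoeff f = 1) : IsHighestWeight S n (fun _ => f) := by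
  obtain ⟨ρ, hρ⟩ := exists_scalar_algHom S n f hf
  refine ⟨ρ.toLinearMap, by simp, ?_, ?_⟩
  · intro x i j r hij
    have : i ≠ j := by rintro rfl; exact lt_irrefl _ hij
    simp [hρ, this]
  · intro x i r
    simp [hρ, mul_comm]

/-- If `1` were in the ideal, finitely many generators would produce it. These involve finitely many
coefficients of `λ(u)`, so `1` would also be in the ideal of a close enough `μ(u)`. -/
theorem IsHighestWeight.of_approx {lam : ℤ → PowerSeries ℂ}
    (h : ∀ R : ℕ, ∃ mu, IsHighestWeight S n mu ∧
      ∀ i ∈ indices S n, ∀ r ≤ R, PowerSeries.coeff r (mu i) = PowerSeries.coeff r (lam i)) :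
    IsHighestWeight S n lam := by
  classical
  rw [isHighestWeight_iff, nontrivial_verma_iff]
  intro h1
  obtain ⟨T, hT, h1⟩ := Submodule.mem_span_finite_of_mem_span h1
  have : ∃ R : ℕ, ∀ mu : ℤ → PowerSeries ℂ,
      (∀ i ∈ indices S n, ∀ r ≤ R, PowerSeries.coeff r (mu i) = PowerSeries.coeff r (lam i)) →
      ∀ x ∈ T, x ∈ vermaIdeal S n mu := by
    clear h1
    induction T using Finset.induction_on with
    | empty => exact ⟨0, by simp⟩
    | insert a T _ ih =>
      rw [Finset.coe_insert, Set.insert_subset_iff] at hT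
      obtain ⟨R, hR⟩ := ih hT.2
      rcases hT.1 with ⟨i, j, r, hij, rfl⟩ | ⟨i, r, rfl⟩
      · refine ⟨R, fun mu hmu x hx => ?_⟩
        rcases Finset.mem_insert.1 hx with rfl | hx
        · exact Submodule.subset_span (Or.inl ⟨i, j, r, hij, rfl⟩)
        · exact hR mu hmu x hx
      · refine ⟨max R r, fun mu hmu x hx => ?_⟩
        rcases Finset.mem_insert.1 hx with rfl | hx
        · rw [← hmu i.1 i.2 r (le_max_right _ _)]
          exact Submodule.subset_span (Or.inr ⟨i, r, rfl⟩)
        · exact hR mu (fun i hi s hs => hmu i hi s (hs.trans (le_max_left _ _))) x hx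
  obtain ⟨R, hR⟩ := this
  obtain ⟨mu, hmu, e⟩ := h R
  rw [isHighestWeight_iff, nontrivial_verma_iff] at hmu
  exact hmu (Submodule.span_le.2 (hR mu e) h1)

end ExtYangian

/-! ### Weight grading, degree filtration and polynomial dependence on the highest weight. -/

namespace ExtYangian
open ClassicalSeries

variable {S : ClassicalSeries} {n : ℕ}

/-- The relations are homogeneous for the weight `i - j` of `t_{ij}`: every term has weight
`(i-j)+(k-l)`, because `p` and `-p` cancel in the sums. -/
theorem RTT.weight_mul {B : Type*} [Ring B] [Algebra ℂ B] {a b c : B}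
    {T T' : Matrix (Idx S n) (Idx S n) B} (h : RTT a b c T T') (τ : ℤ → B)
    (hτ : ∀ w x, Commute (τ w) x) (hadd : ∀ w w', τ w * τ w' = τ (w + w')) :
    RTT a b c (Matrix.of fun i j => T i j * τ (i - j)) (Matrix.of fun i j => T' i j * τ (i - j)) := by
  intro i j k l
  have h1 : ∀ x y w w', (x * τ w) * (y * τ w') = x * y * τ (w + w') := by
    intro x y w w'
    rw [mul_assoc, ← mul_assoc (τ w), (hτ w y).eq, mul_assoc, hadd, mul_assoc]
  have h2 : ∀ w w' (x : B), w = w' → x * τ w = x * τ w' := by rintro w _ x rfl; rfl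
  have e1 : ∀ p : Idx S n, k = -i → theta S i p • ((T p j * τ (p - j)) *
      (T' (-p) l * τ ((-p : Idx S n) - l))) =
      (theta S i p • (T p j * T' (-p) l)) * τ (i - j + (k - l)) := by
    rintro p rfl
    rw [h1, smul_mul_assoc, h2 _ (i - j + ((-i : Idx S n) - l))]
    simp only [coe_neg]; ring
  have e2 : ∀ p : Idx S n, l = -j → theta S j p • ((T' k (-p) * τ (k - (-p : Idx S n))) *
      (T i p * τ (i - p))) =
      (theta S j p • (T' k (-p) * T i p)) * τ (i - j + (k - l)) := by
    rintro p rfl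
    rw [h1, smul_mul_assoc, h2 _ (i - j + (k - (-j : Idx S n)))]
    simp only [coe_neg]; ring
  have f1 : (if k = -i then ∑ p : Idx S n, theta S i p • ((T p j * τ (p - j)) *
      (T' (-p) l * τ ((-p : Idx S n) - l))) else 0) = (if k = -i then
      ∑ p : Idx S n, theta S i p • (T p j * T' (-p) l) else 0) * τ (i - j + (k - l)) := by
    split_ifs with hk
    · rw [Finset.sum_mul]; exact Finset.sum_congr rfl fun p _ => e1 p hk
    · rw [zero_mul]
  have f2 : (if l = -j then ∑ p : Idx S n, theta S j p • ((T' k (-p) * τ (k - (-p : Idx S n))) *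
      (T i p * τ (i - p))) else 0) = (if l = -j then
      ∑ p : Idx S n, theta S j p • (T' k (-p) * T i p) else 0) * τ (i - j + (k - l)) := by
    split_ifs with hk
    · rw [Finset.sum_mul]; exact Finset.sum_congr rfl fun p _ => e2 p hk
    · rw [zero_mul]
  simp only [Matrix.of_apply]
  rw [f1, f2, h1, h1, h1, h1, h2 ((k : ℤ) - l + (i - j)) (i - j + (k - l)) _ (by ring),
    h2 ((k : ℤ) - j + (i - l)) (i - j + (k - l)) _ (by ring),
    h2 ((k : ℤ) - j + (i - l)) (i - j + (k - l)) _ (by ring), ← sub_mul, ← sub_mul, ← sub_mul,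
    ← mul_assoc, ← mul_assoc, ← mul_assoc, ← sub_mul, h i j k l]

theorem IsRTT.weight_mul {A : Type*} [Ring A] [Algebra ℂ A]
    {T : Matrix (Idx S n) (Idx S n) (PowerSeries A)} (h : IsRTT T) (τ : ℤ → A)
    (hτ : ∀ w x, τ w * x = x * τ w) (hadd : ∀ w w', τ w * τ w' = τ (w + w')) (h0 : τ 0 = 1) :
    IsRTT (Matrix.of fun i j : Idx S n => T i j * PowerSeries.C (τ ((i : ℤ) - j))) where
  coeff_zero i j := by
    rw [Matrix.of_apply, PowerSeries.coeff_mul_C, h.coeff_zero]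
    by_cases hij : i = j
    · subst hij; simp [h0]
    · simp [hij]
  rtt := by
    have := h.rtt.weight_mul (fun w => PowerSeries.C (PowerSeries.C (τ w)))
      (fun w x => by ext r s; simp [hτ]) (fun w w' => by simp [← map_mul, hadd])
    convert this using 1
    · ext i j r s : 4
      simp [serU]
    · ext i j r s : 4
      simp [serV]

theorem exists_grading (S : ClassicalSeries) (n : ℕ) :
    ∃ γ : X S n →ₐ[ℂ] AddMonoidAlgebra (X S n) ℤ, ∀ (i j : Idx S n) r,
      γ (t i j r) = AddMonoidAlgebra.single ((i : ℤ) - j) (t i j r) := by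
  obtain ⟨γ, hγ⟩ := ((IsRTT.map (S := S) (n := n) (A' := AddMonoidAlgebra (X S n) ℤ)
    AddMonoidAlgebra.singleZeroAlgHom).weight_mul (fun w => AddMonoidAlgebra.single w 1)
    (fun w x => AddMonoidAlgebra.single_commute (fun _ => AddCommute.all _ _)
      (fun r => Commute.one_left r) x)
    (fun w w' => by rw [AddMonoidAlgebra.single_mul_single, one_mul])
    AddMonoidAlgebra.one_def.symm).exists_lift
  refine ⟨γ, fun i j r => ?_⟩
  rw [hγ, Matrix.of_apply, PowerSeries.coeff_mul_C, Matrix.map_apply, PowerSeries.coeff_map,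
    coeff_tMat]
  change AddMonoidAlgebra.single 0 (t i j r) * _ = _
  rw [AddMonoidAlgebra.single_mul_single, zero_add, mul_one]

/-- The product of the generators in a list. -/
noncomputable def monomial (l : List (Idx S n × Idx S n × ℕ)) : X S n :=
  (l.map fun g => t g.1 g.2.1 g.2.2).prod

/-- The sum of the degrees `r` of the factors `t_{ij}^{(r)}`. -/
def degree (l : List (Idx S n × Idx S n × ℕ)) : ℕ := (l.map fun g => g.2.2).sum

/-- The sum of the weights `i - j` of the factors `t_{ij}^{(r)}`. -/
def weight (l : List (Idx S n × Idx S n × ℕ)) : ℤ := (l.map fun g => (g.1 : ℤ) - g.2.1).sum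

@[simp] theorem monomial_nil : monomial ([] : List (Idx S n × Idx S n × ℕ)) = 1 := rfl
@[simp] theorem degree_nil : degree ([] : List (Idx S n × Idx S n × ℕ)) = 0 := rfl
@[simp] theorem weight_nil : weight ([] : List (Idx S n × Idx S n × ℕ)) = 0 := rfl

@[simp] theorem monomial_cons (g : Idx S n × Idx S n × ℕ) (l) :
    monomial (g :: l) = t g.1 g.2.1 g.2.2 * monomial l := by simp [monomial]
@[simp] theorem degree_cons (g : Idx S n × Idx S n × ℕ) (l) :
    degree (g :: l) = g.2.2 + degree l := by simp [degree]
@[simp] theorem weight_cons (g : Idx S n × Idx S n × ℕ) (l) :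
    weight (g :: l) = (g.1 : ℤ) - g.2.1 + weight l := by simp [weight]

@[simp] theorem monomial_append (l l' : List (Idx S n × Idx S n × ℕ)) :
    monomial (l ++ l') = monomial l * monomial l' := by simp [monomial]
@[simp] theorem degree_append (l l' : List (Idx S n × Idx S n × ℕ)) :
    degree (l ++ l') = degree l + degree l' := by simp [degree]
@[simp] theorem weight_append (l l' : List (Idx S n × Idx S n × ℕ)) :
    weight (l ++ l') = weight l + weight l' := by simp [weight]

theorem mem_span_monomial (x : X S n) :
    x ∈ Submodule.span ℂ (Set.range (monomial (S := S) (n := n))) := by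
  obtain ⟨y, rfl⟩ := RingQuot.mkAlgHom_surjective ℂ (Rel S n) x
  induction y using FreeAlgebra.induction with
  | grade0 c =>
    rw [AlgHom.commutes, Algebra.algebraMap_eq_smul_one]
    exact Submodule.smul_mem _ _ (Submodule.subset_span ⟨[], rfl⟩)
  | grade1 p =>
    obtain ⟨i, j, r⟩ := p
    refine Submodule.subset_span ⟨[(i, j, (r : ℕ))], ?_⟩
    have : ((r : ℕ) : ℤ) = ((r.natPred : ℕ) : ℤ) + 1 := by
      have := r.natPred_add_one
      omega
    simp only [monomial_cons, monomial_nil, mul_one, t]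
    rw [this, tFree_of_pos]
    rw [show (⟨r.natPred + 1, r.natPred.succ_pos⟩ : ℕ+) = r from PNat.eq r.natPred_add_one]
  | mul a b ha hb =>
    rw [map_mul]
    have := Submodule.mul_mem_mul ha hb
    rw [Submodule.span_mul_span] at this
    refine Submodule.span_mono ?_ this
    rintro _ ⟨_, ⟨l, rfl⟩, _, ⟨l', rfl⟩, rfl⟩
    exact ⟨l ++ l', monomial_append l l'⟩
  | add a b ha hb => rw [map_add]; exact add_mem ha hb

/-- The span of the monomials of the given weight and of bounded degree. -/
noncomputable def filtration (S : ClassicalSeries) (n : ℕ) (d w : ℤ) : Submodule ℂ (X S n) :=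
  Submodule.span ℂ {x | ∃ l, (degree l : ℤ) ≤ d ∧ weight l = w ∧ x = monomial l}

theorem filtration_mono {d d' w : ℤ} (h : d ≤ d') : filtration S n d w ≤ filtration S n d' w :=
  Submodule.span_mono fun _ ⟨l, h1, h2, h3⟩ => ⟨l, h1.trans h, h2, h3⟩

theorem mul_mem_filtration {d d' w w' : ℤ} {x y : X S n} (hx : x ∈ filtration S n d w)
    (hy : y ∈ filtration S n d' w') : x * y ∈ filtration S n (d + d') (w + w') := by
  have := Submodule.mul_mem_mul hx hy
  rw [filtration, filtration, Submodule.span_mul_span] at this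
  refine Submodule.span_mono ?_ this
  rintro _ ⟨_, ⟨l, h1, h2, rfl⟩, _, ⟨l', h1', h2', rfl⟩, rfl⟩
  exact ⟨l ++ l', by simp; omega, by simp [h2, h2'], by simp⟩

theorem monomial_mem_filtration (l : List (Idx S n × Idx S n × ℕ)) :
    monomial l ∈ filtration S n (degree l) (weight l) :=
  Submodule.subset_span ⟨l, le_rfl, rfl, rfl⟩

theorem mkAlgHom_tFree_mem (i j : Idx S n) (r : ℤ) :
    RingQuot.mkAlgHom ℂ (Rel S n) (tFree i j r) ∈ filtration S n r (i - j) := by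
  rcases lt_or_ge r 0 with h | h
  · rw [tFree_of_neg i j h, map_zero]; exact zero_mem _
  · lift r to ℕ using h
    exact Submodule.subset_span ⟨[(i, j, r)], by simp, by simp, by simp [t]⟩

theorem mulUSubVSub_mem (M : Submodule ℂ (FreeGen S n)) (a : ℂ) (c : ℤ → ℤ → FreeGen S n) (r s : ℤ)
    (h1 : c (r + 1) s ∈ M) (h2 : c r (s + 1) ∈ M) (h3 : c r s ∈ M) : mulUSubVSub a c r s ∈ M :=
  sub_mem (sub_mem h1 h2) (M.smul_mem a h3)

/-- Commutators of generators drop the degree by one, so the associated graded algebra is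
commutative. The right side of the relation carries one factor `u-v` or `u-v-κ` and the left side
carries two. -/
theorem commutator_mem (i j k l : Idx S n) (r s : ℤ) :
    RingQuot.mkAlgHom ℂ (Rel S n) (commSeries i j k l r s) ∈
      filtration S n (r + s - 1) (i - j + (k - l)) := by
  set q := RingQuot.mkAlgHom ℂ (Rel S n) with hq
  set w : ℤ := i - j + (k - l) with hw
  let M : ℤ → Submodule ℂ (FreeGen S n) := fun d => (filtration S n d w).comap q.toLinearMap
  have hM : ∀ {d d'}, d ≤ d' → M d ≤ M d' := fun h => Submodule.comap_mono (filtration_mono h)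
  have hmul : ∀ (i j k l : Idx S n) r s d, r + s ≤ d → (i : ℤ) - j + (k - l) = w →
      tFree i j r * tFree k l s ∈ M d := by
    intro i j k l r s d h hw
    refine hM h ?_
    simp only [M, Submodule.mem_comap, AlgHom.toLinearMap_apply, map_mul, ← hw]
    exact mul_mem_filtration (mkAlgHom_tFree_mem i j r) (mkAlgHom_tFree_mem k l s)
  have hcomm : ∀ r s d, r + s ≤ d → commSeries i j k l r s ∈ M d := fun r s d h =>
    sub_mem (hmul _ _ _ _ _ _ _ h hw.symm) (hmul _ _ _ _ _ _ _ (by omega) (by omega))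
  have hperm : ∀ r s d, r + s ≤ d → permSeries i j k l r s ∈ M d := fun r s d h =>
    sub_mem (hmul _ _ _ _ _ _ _ h (by omega)) (hmul _ _ _ _ _ _ _ (by omega) (by omega))
  have htrans : ∀ r s d, r + s ≤ d → transSeries i j k l r s ∈ M d := by
    intro r s d h
    refine sub_mem ?_ ?_
    · split_ifs with hk
      · subst hk
        refine sum_mem fun p _ => Submodule.smul_mem _ _ (hmul _ _ _ _ _ _ _ h ?_)
        simp only [coe_neg, hw]; ring
      · exact zero_mem _
    · split_ifs with hk
      · subst hk
        refine sum_mem fun p _ => Submodule.smul_mem _ _ (hmul _ _ _ _ _ _ _ (by omega) ?_)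
        simp only [coe_neg, hw]; ring
      · exact zero_mem _
  have hrel : ∀ r s, mulUSubVSub 0 (mulUSubVSub (kappa S n) (commSeries i j k l)) r s ∈
      M (r + s + 1) := by
    intro r s
    have : q (mulUSubVSub 0 (mulUSubVSub (kappa S n) (commSeries i j k l)) r s) = _ :=
      RingQuot.mkAlgHom_rel ℂ (Rel.rtt i j k l r s)
    simp only [M, Submodule.mem_comap, AlgHom.toLinearMap_apply]
    rw [this]
    change _ ∈ M (r + s + 1)
    refine sub_mem (mulUSubVSub_mem _ _ _ _ _ ?_ ?_ ?_) (mulUSubVSub_mem _ _ _ _ _ ?_ ?_ ?_)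
    · exact hperm _ _ _ (by omega)
    · exact hperm _ _ _ (by omega)
    · exact hperm _ _ _ (by omega)
    · exact htrans _ _ _ (by omega)
    · exact htrans _ _ _ (by omega)
    · exact htrans _ _ _ (by omega)
  -- The coefficient of `(u-v)(u-v-κ)[t(u),t(v)]` is a second difference of commutators plus terms
  -- of lower degree; it is solved for the commutator with the largest first index.
  have hstep : ∀ r s, commSeries i j k l (r + 1) (s + 1) ∈ M (r + 1 + (s + 1) - 1) →
      commSeries i j k l r (s + 1 + 1) ∈ M (r + (s + 1 + 1) - 1) →
      commSeries i j k l (r + 1 + 1) s ∈ M (r + 1 + 1 + s - 1) := by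
    intro r s h1 h2
    have h := hrel r s
    have e1 : r + 1 + (s + 1) - 1 = r + s + 1 := by ring
    have e2 : r + (s + 1 + 1) - 1 = r + s + 1 := by ring
    have e3 : r + 1 + 1 + s - 1 = r + s + 1 := by ring
    rw [e1] at h1
    rw [e2] at h2
    rw [e3]
    have h3 := (M (r + s + 1)).smul_mem (kappa S n) (hcomm (r + 1) s _ (by omega))
    have h4 := (M (r + s + 1)).smul_mem (kappa S n) (hcomm r (s + 1) _ (by omega))
    have e : commSeries i j k l (r + 1 + 1) s =
        mulUSubVSub 0 (mulUSubVSub (kappa S n) (commSeries i j k l)) r s +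
          (commSeries i j k l (r + 1) (s + 1) + commSeries i j k l (r + 1) (s + 1)) -
          commSeries i j k l r (s + 1 + 1) + kappa S n • commSeries i j k l (r + 1) s -
          kappa S n • commSeries i j k l r (s + 1) := by
      simp only [mulUSubVSub]
      module
    rw [e]
    exact sub_mem (add_mem (sub_mem (add_mem h (add_mem h1 h1)) h2) h3) h4
  have hneg : ∀ r s, r < 0 → commSeries i j k l r s = 0 := by
    intro r s h; simp [commSeries, tFree_of_neg i j h]
  have h0 : ∀ s, commSeries i j k l 0 s = 0 := by
    intro s; simp only [commSeries, tFree_zero]; split_ifs <;> simp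
  -- The recursion has order two in `r`, so two consecutive values are carried along, for all `s` at
  -- once.
  have hnat : ∀ (r : ℕ) s, commSeries i j k l r s ∈ M (r + s - 1) ∧
      commSeries i j k l (r + 1) s ∈ M (r + 1 + s - 1) := by
    intro r
    induction r with
    | zero =>
      intro s
      refine ⟨by rw [Nat.cast_zero, h0]; exact zero_mem _, ?_⟩
      have := hstep (-1) s (by rw [neg_add_cancel, h0]; exact zero_mem _)
        (by rw [hneg _ _ (by omega)]; exact zero_mem _)
      simpa using this
    | succ r ih =>
      intro s
      push_cast
      exact ⟨(ih s).2, hstep r s (ih (s + 1)).2 (ih _).1⟩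
  rcases lt_or_ge r 0 with h | h
  · rw [hneg _ _ h, map_zero]; exact zero_mem _
  · lift r to ℕ using h
    exact (hnat r s).1

theorem monomial_sub_mem_of_perm {l l' : List (Idx S n × Idx S n × ℕ)} (h : l.Perm l') :
    degree l = degree l' ∧ weight l = weight l' ∧
      monomial l - monomial l' ∈ filtration S n (degree l - 1) (weight l) := by
  induction h with
  | nil => simp
  | cons g _ ih =>
    refine ⟨by simp [ih.1], by simp [ih.2.1], ?_⟩
    have := mul_mem_filtration (mkAlgHom_tFree_mem g.1 g.2.1 g.2.2) ih.2.2
    simp only [monomial_cons, ← mul_sub, degree_cons, weight_cons]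
    convert this using 2
    · push_cast; ring
    · rw [t]
  | swap g g' l =>
    refine ⟨by simp; omega, by simp; omega, ?_⟩
    have := mul_mem_filtration (commutator_mem g'.1 g'.2.1 g.1 g.2.1 g'.2.2 g.2.2)
      (monomial_mem_filtration l)
    simp only [monomial_cons, degree_cons, weight_cons]
    convert this using 2
    · push_cast; ring
    · ring
    · simp only [commSeries, map_sub, map_mul, sub_mul, mul_assoc, t]
  | trans _ _ ih1 ih2 =>
    refine ⟨ih1.1.trans ih2.1, ih1.2.1.trans ih2.2.1, ?_⟩
    have := add_mem ih1.2.2 (ih1.1 ▸ ih1.2.1 ▸ ih2.2.2)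
    simpa using this

/-- The evaluation of a polynomial at the coefficients of the series `λ_i(u)`. -/
noncomputable def evalWeight (lam : ℤ → PowerSeries ℂ) : MvPolynomial (ℤ × ℕ) ℂ →ₐ[ℂ] ℂ :=
  MvPolynomial.aeval fun p => PowerSeries.coeff p.2 (lam p.1)

/-- The elements on which every functional of highest weight takes a value which is polynomial in
the highest weight. -/
def polynomialValued (S : ClassicalSeries) (n : ℕ) : Submodule ℂ (X S n) where
  carrier := {x | ∃ p, ∀ lam φ, IsHighestWeightFunctional lam φ → φ x = evalWeight lam p}
  zero_mem' := ⟨0, by simp⟩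
  add_mem' := by
    rintro x y ⟨p, hp⟩ ⟨q, hq⟩
    exact ⟨p + q, fun lam φ h => by rw [map_add, map_add, hp lam φ h, hq lam φ h]⟩
  smul_mem' := by
    rintro c x ⟨p, hp⟩
    exact ⟨c • p, fun lam φ h => by rw [map_smul, map_smul, hp lam φ h]⟩

theorem monomial_mem_polynomialValued_of_diag (l : List (Idx S n × Idx S n × ℕ))
    (h : ∀ g ∈ l, g.1 = g.2.1) : monomial l ∈ polynomialValued S n := by
  induction l using List.reverseRecOn with
  | nil => exact ⟨1, fun lam φ h => by simp [h.map_one]⟩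
  | append_singleton l g ih =>
    obtain ⟨p, hp⟩ := ih fun g hg => h g (by simp [hg])
    refine ⟨MvPolynomial.X (g.1.1, g.2.2) * p, fun lam φ hφ => ?_⟩
    have hg := h g (by simp)
    rw [monomial_append, monomial_cons, monomial_nil, mul_one, ← hg, hφ.map_mul_diag, map_mul,
      hp lam φ hφ]
    simp [evalWeight]

theorem diag_of_weight_eq_zero (l : List (Idx S n × Idx S n × ℕ)) (hw : weight l ≤ 0)
    (h : ∀ g ∈ l, ¬ g.1.1 < g.2.1.1) : 0 ≤ weight l ∧ ∀ g ∈ l, g.1 = g.2.1 := by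
  induction l with
  | nil => simp
  | cons g l ih =>
    have hg := h g (by simp)
    have h' : ∀ g ∈ l, ¬ g.1.1 < g.2.1.1 := fun g hg => h g (by simp [hg])
    rw [weight_cons] at hw ⊢
    have := ih (by omega) h'
    refine ⟨by omega, fun g' hg' => ?_⟩
    rcases List.mem_cons.1 hg' with rfl | hg'
    · exact Subtype.ext (by omega)
    · exact this.2 g' hg'

/-- A raising factor can be moved to the right end, where `φ` kills the monomial; the correction has
the same weight and lower degree. Without raising factors all weights are nonnegative, so total
weight zero leaves only diagonal generators, whose product has a value monomial in the coefficients
of `λ(u)`. -/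
theorem monomial_mem_polynomialValued (d : ℕ) : ∀ l : List (Idx S n × Idx S n × ℕ),
    degree l < d → weight l = 0 → monomial l ∈ polynomialValued S n := by
  induction d with
  | zero => intro l h; omega
  | succ d ih =>
    intro l hd hw
    by_cases hl : ∃ g ∈ l, g.1.1 < g.2.1.1
    · obtain ⟨g, hg, hlt⟩ := hl
      have hperm : l.Perm (l.erase g ++ [g]) :=
        (List.perm_cons_erase hg).trans (List.perm_append_singleton g _).symm
      obtain ⟨-, -, h3⟩ := monomial_sub_mem_of_perm hperm
      rw [← sub_add_cancel (monomial l) (monomial (l.erase g ++ [g]))]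
      refine add_mem ?_ ⟨0, fun lam φ hφ => ?_⟩
      · refine (Submodule.span_le.2 ?_ : filtration S n _ _ ≤ _) h3
        rintro _ ⟨l', h1, h2, rfl⟩
        exact ih l' (by omega) (by rw [h2, hw])
      · rw [monomial_append, monomial_cons, monomial_nil, mul_one, hφ.map_mul_raising _ _ _ _ hlt,
          map_zero]
    · push Not at hl
      exact monomial_mem_polynomialValued_of_diag l
        (diag_of_weight_eq_zero l hw.le fun g hg => not_lt.2 (hl g hg)).2

theorem exists_polynomial_value (x : X S n) : ∃ p, ∀ lam φ, IsHighestWeightFunctional lam φ →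
    (∀ l, weight l ≠ 0 → φ (monomial l) = 0) → φ x = evalWeight lam p := by
  induction mem_span_monomial x using Submodule.span_induction with
  | mem x hx =>
    obtain ⟨l, rfl⟩ := hx
    by_cases h : weight l = 0
    · obtain ⟨p, hp⟩ := monomial_mem_polynomialValued (degree l + 1) l (by omega) h
      exact ⟨p, fun lam φ hφ _ => hp lam φ hφ⟩
    · exact ⟨0, fun lam φ hφ h0 => by rw [h0 l h, map_zero]⟩
  | zero => exact ⟨0, by simp⟩
  | add x y _ _ hx hy =>
    obtain ⟨p, hp⟩ := hx
    obtain ⟨q, hq⟩ := hy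
    exact ⟨p + q, fun lam φ h h' => by rw [map_add, map_add, hp lam φ h h', hq lam φ h h']⟩
  | smul c x _ hx =>
    obtain ⟨p, hp⟩ := hx
    exact ⟨c • p, fun lam φ h h' => by rw [map_smul, map_smul, hp lam φ h h']⟩

/-- Composition with the projection to weight zero makes the functional unique: its values on
monomials of nonzero weight are not determined by `λ(u)` alone otherwise. -/
theorem IsHighestWeight.exists_graded {lam : ℤ → PowerSeries ℂ} (h : IsHighestWeight S n lam) :
    ∃ φ : X S n →ₗ[ℂ] ℂ, IsHighestWeightFunctional lam φ ∧
      ∀ l, weight l ≠ 0 → φ (monomial l) = 0 := by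
  obtain ⟨φ, hφ⟩ := h
  obtain ⟨γ, hγ⟩ := exists_grading S n
  let π : X S n →ₗ[ℂ] X S n :=
    { toFun := fun x => (γ x).coeff 0
      map_add' := fun x y => by rw [map_add, AddMonoidAlgebra.coeff_add, Finsupp.add_apply]
      map_smul' := fun c x => by
        rw [map_smul, AddMonoidAlgebra.coeff_smul_apply, RingHom.id_apply] }
  have hπ : ∀ x (i j : Idx S n) r, π (x * t i j r) = (γ x).coeff (j - i) * t i j r := by
    intro x i j r
    change (γ (x * t i j r)).coeff 0 = _
    rw [map_mul, hγ]
    refine AddMonoidAlgebra.coeff_mul_single_eq_coeff_mul _ fun m _ => ?_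
    constructor <;> intro h <;> omega
  refine ⟨φ ∘ₗ π, ⟨?_, ?_, ?_⟩, ?_⟩
  · have : π 1 = 1 := by
      change (γ 1).coeff 0 = 1
      rw [map_one, AddMonoidAlgebra.one_def, AddMonoidAlgebra.coeff_single,
        Finsupp.single_eq_same]
    rw [LinearMap.comp_apply, this, hφ.map_one]
  · intro x i j r hij
    rw [LinearMap.comp_apply, hπ, hφ.map_mul_raising _ _ _ _ hij]
  · intro x i r
    rw [LinearMap.comp_apply, hπ, sub_self, hφ.map_mul_diag]
    rfl
  · have : ∀ l, γ (monomial l) = AddMonoidAlgebra.single (weight l) (monomial l) := by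
      intro l
      induction l with
      | nil => rw [monomial_nil, map_one, weight_nil, AddMonoidAlgebra.one_def]
      | cons g l ih =>
        rw [monomial_cons, map_mul, hγ, ih, AddMonoidAlgebra.single_mul_single, weight_cons]
    intro l hl
    have : π (monomial l) = 0 := by
      change (γ (monomial l)).coeff 0 = 0
      rw [this, AddMonoidAlgebra.coeff_single, Finsupp.single_eq_of_ne hl.symm]
    rw [LinearMap.comp_apply, this, map_zero]

/-- The highest weights form a Zariski closed set; here, for a polynomial curve. -/
theorem IsHighestWeight.of_forall_nat (lam : ℂ → ℤ → PowerSeries ℂ)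
    (hpoly : ∀ i r, ∃ q : Polynomial ℂ, ∀ c, PowerSeries.coeff r (lam c i) = q.eval c)
    (h : ∀ m : ℕ, IsHighestWeight S n (lam m)) (c : ℂ) : IsHighestWeight S n (lam c) := by
  choose φ hφ hφ0 using fun m => (h m).exists_graded
  choose q hq using hpoly
  -- A polynomial is determined by its values at the natural numbers. Hence the interpolating
  -- polynomial `Q x` depends linearly on `x`, and every identity satisfied by all `φ m` passes to
  -- the value at `c`.
  have hinj : ∀ P Q : Polynomial ℂ, (∀ m : ℕ, P.eval (m : ℂ) = Q.eval (m : ℂ)) → P = Q := by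
    intro P Q hPQ
    refine Polynomial.eq_of_infinite_eval_eq P Q ((Set.infinite_range_of_injective
      (Nat.cast_injective (R := ℂ))).mono ?_)
    rintro _ ⟨m, rfl⟩
    exact hPQ m
  have hex : ∀ x, ∃ Q : Polynomial ℂ, ∀ m : ℕ, φ m x = Q.eval (m : ℂ) := by
    intro x
    obtain ⟨p, hp⟩ := exists_polynomial_value x
    refine ⟨MvPolynomial.aeval (fun y => q y.1 y.2) p, fun m => ?_⟩
    rw [hp _ _ (hφ m) (hφ0 m), evalWeight, ← Polynomial.coe_aeval_eq_eval,
      ← AlgHom.coe_toRingHom, ← AlgHom.comp_apply, MvPolynomial.comp_aeval]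
    simp [hq]
  choose Q hQ using hex
  let Φ : X S n →ₗ[ℂ] ℂ :=
    { toFun := fun x => (Q x).eval c
      map_add' := fun x y => by
        rw [hinj (Q (x + y)) (Q x + Q y) fun m => by simp [← hQ], Polynomial.eval_add]
      map_smul' := fun a x => by
        rw [hinj (Q (a • x)) (a • Q x) fun m => by simp [← hQ]]; simp }
  have hΦ : ∀ x, Φ x = (Q x).eval c := fun _ => rfl
  refine ⟨Φ, ?_, ?_, ?_⟩
  · rw [hΦ, hinj (Q 1) 1 fun m => by simp [← hQ, (hφ m).map_one], Polynomial.eval_one]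
  · intro x i j r hij
    rw [hΦ, hinj (Q _) 0 fun m => by simp [← hQ, (hφ m).map_mul_raising _ _ _ _ hij],
      Polynomial.eval_zero]
  · intro x i r
    rw [hΦ, hinj (Q _) (q i.1 r * Q x) fun m => by
      simp [← hQ, ← hq, (hφ m).map_mul_diag], Polynomial.eval_mul, ← hq, hΦ]

end ExtYangian

/-! ### The vector representation. -/

namespace ExtYangian
open ClassicalSeries

variable {S : ClassicalSeries} {n : ℕ}

/-- The sign `θ_{i,-i}`: `1` in the orthogonal case and `-1` in the symplectic case. -/
def epsilon (S : ClassicalSeries) : ℂ :=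
  match S with
  | B => 1
  | C => -1
  | D => 1

theorem theta_neg_right (i j : ℤ) : theta S i (-j) = epsilon S * theta S i j := by
  cases S <;> simp [theta, epsilon]

theorem theta_neg_left' (i j : ℤ) : theta S (-i) j = epsilon S * theta S i j := by
  rw [theta_neg_left, theta_neg_right]

theorem ne_zero_of_mem_indices (h : S ≠ B) (i : Idx S n) : (i : ℤ) ≠ 0 := by
  have := i.2
  simp only [indices, if_neg h] at this
  exact (Finset.mem_erase.1 this).1

theorem theta_mul_theta (i p j : Idx S n) : theta S i p * theta S p j = theta S i j := by
  cases S
  · simp [theta]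
  · have : Int.sign p * Int.sign p = 1 := by
      rcases lt_or_gt_of_ne (ne_zero_of_mem_indices (by simp) p) with h | h
      · simp [Int.sign_eq_neg_one_of_neg h]
      · simp [Int.sign_eq_one_of_pos h]
    simp only [theta]
    rw [← Int.cast_mul, ← mul_one (Int.sign i * Int.sign j), ← this]
    congr 1
    ring
  · simp [theta]

theorem card_idx (S : ClassicalSeries) (n : ℕ) : Fintype.card (Idx S n) = matSize S n := by
  rw [Fintype.card_coe, indices]
  cases S
  · simp [matSize]; omega
  · rw [if_neg (by simp), Finset.card_erase_of_mem (by simp)]; simp [matSize]; omega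
  · rw [if_neg (by simp), Finset.card_erase_of_mem (by simp)]; simp [matSize]; omega

/-- The only property of the number `κ` that is used; it enters through the cross terms of the
vector representation. -/
theorem kappa_eq (S : ClassicalSeries) (n : ℕ) :
    2 * epsilon S * kappa S n + 2 = epsilon S * (Fintype.card (Idx S n) : ℂ) := by
  rw [card_idx]
  cases S <;> simp [epsilon, kappa] <;> ring

section MatrixUnits

variable {K B : Type*} [CommRing K] [Ring B] [Algebra K B]

/-- The Kronecker delta. -/
def delta (K : Type*) [CommRing K] (i j : Idx S n) : K := if i = j then 1 else 0

theorem delta_comm (i j : Idx S n) : delta K i j = delta K j i := by simp [delta, eq_comm]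

theorem delta_neg_left (i j : Idx S n) : delta K (-i) j = delta K i (-j) := by
  have : -i = j ↔ i = -j := ⟨fun h => by rw [← h, neg_neg], fun h => by rw [h, neg_neg]⟩
  simp [delta, this]

theorem sum_delta_smul (i : Idx S n) (f : Idx S n → B) : ∑ p, delta K p i • f p = f i := by
  simp [delta]

/-- The matrix with entries `δ_{ij} - α e_{ji} + β θ_{ij} e_{-i,-j}`. -/
def vectorMat (e : Idx S n → Idx S n → B) (θ : Idx S n → Idx S n → K) (α β : K) :
    Matrix (Idx S n) (Idx S n) B :=
  Matrix.of fun i j => delta K i j • 1 - α • e j i + (β * θ i j) • e (-i) (-j)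

variable {e : Idx S n → Idx S n → B} {θ : Idx S n → Idx S n → K} {ε : K}

theorem vectorMat_commutator (he : ∀ i j k l, e i j * e k l = delta K j k • e i l)
    (α β α' β' : K) (i j k l : Idx S n) :
    vectorMat e θ α β i j * vectorMat e θ α' β' k l -
      vectorMat e θ α' β' k l * vectorMat e θ α β i j =
    (α * α' * delta K i l) • e j k - (α * α' * delta K k j) • e l i
    - (α * β' * θ k l * delta K k (-i)) • e j (-l) + (α * β' * θ k l * delta K l (-j)) • e (-k) i
    - (β * α' * θ i j * delta K l (-j)) • e (-i) k + (β * α' * θ i j * delta K k (-i)) • e l (-j)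
    + (β * β' * (θ i j * θ k l) * delta K k j) • e (-i) (-l)
    - (β * β' * (θ i j * θ k l) * delta K i l) • e (-k) (-j) := by
  have h1 : delta K (-j) l = delta K l (-j) := delta_comm _ _
  have h2 : delta K (-l) j = delta K l (-j) := delta_neg_left _ _
  have h3 : delta K i (-k) = delta K k (-i) := by rw [delta_comm, delta_neg_left]
  have h4 : delta K (-l) (-i) = delta K i l := by rw [delta_neg_left, neg_neg, delta_comm]
  have h5 : delta K (-j) (-k) = delta K k j := by rw [delta_neg_left, neg_neg, delta_comm]
  simp only [vectorMat, Matrix.of_apply, mul_add, add_mul, mul_sub, sub_mul, smul_mul_assoc,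
    mul_smul_comm, he, one_mul, mul_one, h1, h2, h3, h4, h5]
  module

theorem vectorMat_perm (he : ∀ i j k l, e i j * e k l = delta K j k • e i l)
    (α β α' β' : K) (i j k l : Idx S n) :
    vectorMat e θ α β k j * vectorMat e θ α' β' i l -
      vectorMat e θ α' β' k j * vectorMat e θ α β i l =
    ((α - α') * delta K k j) • e l i + ((β' - β) * delta K k j * θ i l) • e (-i) (-l)
    + ((α' - α) * delta K i l) • e j k + ((β - β') * delta K i l * θ k j) • e (-k) (-j)
    + ((α' * β - α * β') * delta K k (-i)  * θ i l) • e j (-l)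
    - ((α' * β - α * β') * delta K l (-j) * θ k j) • e (-k) i := by
  have h1 : delta K (-j) l = delta K l (-j) := delta_comm _ _
  simp only [vectorMat, Matrix.of_apply, mul_add, add_mul, mul_sub, sub_mul, smul_mul_assoc,
    mul_smul_comm, he, one_mul, mul_one, h1]
  module

/-- Two families of products do not single out one `p`. The products `e_{jp} e_{p,-l}` all equal
`e_{j,-l}`, which brings in the number of labels; for `l = -j` the products `e_{-p,-j} e_{l,-p}` are
the idempotents `e_{-p,-p}`, which sum to `1`. -/
theorem vectorMat_trans_left (he : ∀ i j k l, e i j * e k l = delta K j k • e i l)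
    (he1 : ∑ p, e p p = 1) (hθ : ∀ i p j, θ i p * θ p j = θ i j)
    (hθn : ∀ i j, θ (-i) j = ε * θ i j) (hθs : ∀ i j, θ i j = θ j i)
    (α β α' β' : K) (i j l : Idx S n) :
    ∑ p, θ i p • (vectorMat e θ α β p j * vectorMat e θ α' β' (-p) l) =
    ((1 - β * α') * θ i j * delta K l (-j)) • 1 + ((β - α') * θ i j) • e l (-j)
    + ((ε * (β' - α - Fintype.card (Idx S n) * (α * β')) + α * α' + β * β') * θ i l) • e j (-l) := by
  have hθn' : ∀ i j, θ i (-j) = ε * θ i j := fun i j => by rw [hθs, hθn, hθs]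
  have hone : ∑ p : Idx S n, e (-p) (-p) = 1 := by
    rw [← he1]; exact Fintype.sum_equiv (Equiv.neg _) _ _ fun _ => rfl
  have hterm : ∀ p, θ i p • (vectorMat e θ α β p j * vectorMat e θ α' β' (-p) l) =
      delta K p j • (θ i p • (delta K (-p) l • (1 : B) - α' • e l (-p) + (β' * θ (-p) l) • e p (-l)))
      + delta K p (-l) • (θ i p • (-(α • e j p) + (β * θ p j) • e (-p) (-j)))
      + delta K p l • ((α * α' * θ i p) • e j (-p)) - (ε * α * β' * θ i l) • e j (-l)
      - (β * α' * θ i j * delta K l (-j)) • e (-p) (-p)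
      + delta K p (-j) • ((β * β' * θ i p * θ p j * θ (-p) l) • e (-p) (-l)) := by
    intro p
    have h1 : delta K (-p) l = delta K p (-l) := delta_neg_left _ _
    have h2 : delta K (-j) p = delta K p (-j) := delta_comm _ _
    have h3 : delta K (-j) l = delta K l (-j) := delta_comm _ _
    have h4 : (θ i p * θ (-p) l) • e j (-l) = (ε * θ i l) • e j (-l) := by
      rw [hθn, mul_left_comm, hθ]
    have h5 : delta K p p = 1 := by simp [delta]
    have h6 : (θ i p * θ p j) • e (-p) (-p) = θ i j • e (-p) (-p) := by rw [hθ]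
    simp only [vectorMat, Matrix.of_apply, mul_add, add_mul, mul_sub, sub_mul, smul_mul_assoc,
      mul_smul_comm, he, one_mul, mul_one, h1, h2, h3, h5, neg_neg]
    linear_combination (norm := module) (-(α * β')) • h4 - (β * α' * delta K l (-j)) • h6
  simp only [hterm, Finset.sum_add_distrib, Finset.sum_sub_distrib, sum_delta_smul,
    ← Finset.smul_sum, hone, Finset.sum_const, Finset.card_univ, neg_neg]
  have h1 : delta K (-j) l = delta K l (-j) := delta_comm _ _
  have h2 : (θ i j * θ (-j) l) • e j (-l) = (ε * θ i l) • e j (-l) := by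
    rw [hθn, mul_left_comm, hθ]
  have h3 : (θ i (-l) * θ (-l) j) • e l (-j) = θ i j • e l (-j) := by rw [hθ]
  have h4 : (θ i (-j) * θ (-j) j * θ j l) • e j (-l) = θ i l • e j (-l) := by rw [hθ, hθ]
  have h5 : θ i (-l) • e j (-l) = (ε * θ i l) • e j (-l) := by rw [hθn']
  rw [h1, ← Nat.cast_smul_eq_nsmul K]
  linear_combination (norm := module) β' • h2 + β • h3 + (β * β') • h4 - α • h5

theorem vectorMat_trans_right (he : ∀ i j k l, e i j * e k l = delta K j k • e i l)
    (he1 : ∑ p, e p p = 1) (hθ : ∀ i p j, θ i p * θ p j = θ i j)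
    (hθn : ∀ i j, θ (-i) j = ε * θ i j) (hθs : ∀ i j, θ i j = θ j i)
    (α β α' β' : K) (i j k : Idx S n) :
    ∑ p, θ j p • (vectorMat e θ α' β' k (-p) * vectorMat e θ α β i p) =
    ((1 - β * α') * θ i j * delta K k (-i)) • 1 + ((β - α') * θ i j) • e (-i) k
    + ((ε * (β' - α - Fintype.card (Idx S n) * (α * β')) + α * α' + β * β') * θ j k) •
      e (-k) i := by
  have hθn' : ∀ i j, θ i (-j) = ε * θ i j := fun i j => by rw [hθs, hθn, hθs]
  have hone : ∑ p : Idx S n, e (-p) (-p) = 1 := by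
    rw [← he1]; exact Fintype.sum_equiv (Equiv.neg _) _ _ fun _ => rfl
  have hterm : ∀ p, θ j p • (vectorMat e θ α' β' k (-p) * vectorMat e θ α β i p) =
      delta K p i • (θ j p • (delta K k (-p) • (1 : B) - α' • e (-p) k + (β' * θ k (-p)) • e (-k) p))
      + delta K p (-k) • (θ j p • (-(α • e p i) + (β * θ i p) • e (-i) (-p)))
      + delta K p k • ((α * α' * θ j p) • e (-p) i) - (ε * α * β' * θ j k) • e (-k) i
      - (β * α' * θ i j * delta K k (-i)) • e (-p) (-p)
      + delta K p (-i) • ((β * β' * θ j p * θ i p * θ k (-p)) • e (-k) (-p)) := by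
    intro p
    have h1 : delta K k (-p) = delta K p (-k) := by rw [delta_comm, delta_neg_left]
    have h2 : delta K k p = delta K p k := delta_comm _ _
    have h3 : delta K i p = delta K p i := delta_comm _ _
    have h4 : (θ j p * θ k (-p)) • e (-k) i = (ε * θ j k) • e (-k) i := by
      rw [hθn', hθs k, mul_left_comm, hθ]
    have h5 : delta K p p = 1 := by simp [delta]
    have h6 : (θ j p * θ i p) • e (-p) (-p) = θ i j • e (-p) (-p) := by
      rw [hθs i p, hθ, hθs]
    simp only [vectorMat, Matrix.of_apply, mul_add, add_mul, mul_sub, sub_mul, smul_mul_assoc,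
      mul_smul_comm, he, one_mul, mul_one, h1, h2, h3, h5, neg_neg]
    linear_combination (norm := module) (-(α * β')) • h4 - (β * α' * delta K k (-i)) • h6
  simp only [hterm, Finset.sum_add_distrib, Finset.sum_sub_distrib, sum_delta_smul,
    ← Finset.smul_sum, hone, Finset.sum_const, Finset.card_univ, neg_neg]
  have h2 : (θ j i * θ k (-i)) • e (-k) i = (ε * θ j k) • e (-k) i := by
    rw [hθn', hθs k, mul_left_comm, hθ]
  have h3 : (θ j (-k) * θ i (-k)) • e (-i) k = θ j i • e (-i) k := by
    rw [hθs i (-k), hθ]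
  have h4 : (θ j (-i) * θ i (-i) * θ k i) • e (-k) i = θ j k • e (-k) i := by
    rw [hθs i (-i), hθ, hθs k i, hθ]
  have h5 : θ j (-k) • e (-k) i = (ε * θ j k) • e (-k) i := by rw [hθn']
  rw [← Nat.cast_smul_eq_nsmul K, hθs i j]
  linear_combination (norm := module) β' • h2 + β • h3 + (β * β') • h4 - α • h5

variable [Algebra ℂ K] [Algebra ℂ B] [IsScalarTower ℂ K B]

/-- The vector representation satisfies the defining relations of the extended Yangian. -/
theorem vectorMat_rtt (he : ∀ i j k l, e i j * e k l = delta K j k • e i l)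
    (he1 : ∑ p, e p p = 1) {D w α β α' β' : K}
    (h1 : D * (α * α') = w * (α' - α)) (h2 : D * (β * β') = w * (β' - β))
    (h3 : (D - algebraMap ℂ K (kappa S n) * w) * (β * α') = w * (α' - β))
    (h4 : (D + algebraMap ℂ K (kappa S n) * w) * (α * β') = w * (β' - α)) :
    RTT (S := S) (n := n) (algebraMap K B (D * (D - algebraMap ℂ K (kappa S n) * w)))
      (algebraMap K B (w * (D - algebraMap ℂ K (kappa S n) * w))) (algebraMap K B (w * D))
      (vectorMat e (fun i j => algebraMap ℂ K (theta S i j)) α β)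
      (vectorMat e (fun i j => algebraMap ℂ K (theta S i j)) α' β') := by
  set θ : Idx S n → Idx S n → K := fun i j => algebraMap ℂ K (theta S i j) with hθdef
  set κ := algebraMap ℂ K (kappa S n)
  set ε := algebraMap ℂ K (epsilon S)
  have hθ : ∀ i p j, θ i p * θ p j = θ i j := fun i p j => by
    simp only [hθdef, ← map_mul, theta_mul_theta]
  have hθn : ∀ i j, θ (-i) j = ε * θ i j := fun i j => by
    simp only [hθdef, ε, ← map_mul, coe_neg, theta_neg_left']
  have hθs : ∀ i j, θ i j = θ j i := fun i j => by simp only [hθdef, theta_comm]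
  have hN : 2 * ε * κ + 2 = ε * (Fintype.card (Idx S n) : K) := by
    have := congrArg (algebraMap ℂ K) (kappa_eq S n)
    rwa [map_add, map_mul, map_mul, map_mul, map_ofNat, map_natCast] at this
  have hθn' : ∀ i j, θ i (-j) = ε * θ i j := fun i j => by rw [hθs, hθn, hθs]
  have hsmul : ∀ (i j : Idx S n) (x : B), theta S i j • x = θ i j • x := fun i j x =>
    (algebraMap_smul K (theta S i j) x).symm
  -- The coefficient of the cross terms `e_{j,-l}` and `e_{-k,i}`. All other coefficients are
  -- partial fraction identities; this one also needs the relation between `κ` and the size of the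
  -- matrices.
  have hcross : D * (D - κ * w) * (α * β') * ε = - (w * (D - κ * w) * (α' * β - α * β')) +
      w * D * (ε * (β' - α - Fintype.card (Idx S n) * (α * β')) + α * α' + β * β') := by
    linear_combination w * h3 - w * h1 - w * h2 + (ε * D + w) * h4 - w * D * α * β' * hN
  intro i j k l
  simp only [hsmul]
  rw [vectorMat_commutator he, vectorMat_perm he, vectorMat_trans_left he he1 hθ hθn hθs,
    vectorMat_trans_right he he1 hθ hθn hθs]
  have hd1 : θ i j * θ k l * delta K k j = θ i l * delta K k j := by
    by_cases h : k = j
    · rw [h, hθ]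
    · simp [delta, h]
  have hd2 : θ i j * θ k l * delta K i l = θ k j * delta K i l := by
    by_cases h : i = l
    · rw [h, mul_comm (θ l j), hθ]
    · simp [delta, h]
  have hk : θ k l * delta K k (-i) = ε * θ i l * delta K k (-i) := by
    by_cases h : k = -i
    · rw [h, hθn]
    · simp [delta, h]
  have hl : θ k l * delta K l (-j) = ε * θ k j * delta K l (-j) := by
    by_cases h : l = -j
    · rw [h, hθn']
    · simp [delta, h]
  have hite : ∀ (i j : Idx S n) (x : B), (if i = j then x else 0) = delta K i j • x := by
    intro i j x; simp [delta]
  simp only [← Algebra.smul_def, hite]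
  match_scalars
  · linear_combination (D - κ * w) * delta K i l * h1
  · linear_combination -((D - κ * w) * delta K k j) * h1
  · linear_combination -(D * (D - κ * w) * α * β') * hk - θ i l * delta K k (-i) * hcross
  · rw [hθs j k]
    linear_combination D * (D - κ * w) * α * β' * hl + θ k j * delta K l (-j) * hcross
  · linear_combination -(D * θ i j * delta K l (-j)) * h3
  · linear_combination D * θ i j * delta K k (-i) * h3
  · linear_combination D * (D - κ * w) * β * β' * hd1 +
      (D - κ * w) * θ i l * delta K k j * h2
  · linear_combination -(D * (D - κ * w) * β * β') * hd2 -
      (D - κ * w) * θ k j * delta K i l * h2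
  · ring

end MatrixUnits

/-- The series `1 / (u - a)`. -/
noncomputable def pole (a : ℂ) : PowerSeries ℂ :=
  PowerSeries.X * (1 - PowerSeries.C a * PowerSeries.X)⁻¹

theorem inv_one_sub_mul (a : ℂ) :
    (1 - PowerSeries.C a * PowerSeries.X)⁻¹ * (1 - PowerSeries.C a * PowerSeries.X) =
      (1 : PowerSeries ℂ) :=
  PowerSeries.inv_mul_cancel _ (by simp)

theorem pole_mul (a : ℂ) : pole a * (1 - PowerSeries.C a * PowerSeries.X) = PowerSeries.X := by
  rw [pole, mul_assoc, inv_one_sub_mul, mul_one]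

@[simp] theorem coeff_zero_pole (a : ℂ) : PowerSeries.coeff 0 (pole a) = 0 := by
  simp [pole]

/-- Partial fractions: `(u-p) - (v-q) = u - v - (p-q)`, divided by `(u-p)(v-q)`. -/
theorem linFactor_mul_pole (p q : ℂ) :
    linFactor (p - q) * (serU (pole p) * serV (pole q)) =
      (invUV : PowerSeries (PowerSeries ℂ)) * (serV (pole q) - serU (pole p)) := by
  set g := serU (1 - PowerSeries.C p * PowerSeries.X : PowerSeries ℂ)⁻¹
  set h := serV (1 - PowerSeries.C q * PowerSeries.X : PowerSeries ℂ)⁻¹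
  set x : PowerSeries (PowerSeries ℂ) := PowerSeries.X
  set y : PowerSeries (PowerSeries ℂ) := PowerSeries.C PowerSeries.X
  set P : PowerSeries (PowerSeries ℂ) := PowerSeries.C (PowerSeries.C p)
  set Q : PowerSeries (PowerSeries ℂ) := PowerSeries.C (PowerSeries.C q)
  have hg : g * (1 - P * x) = 1 := by
    have := congrArg serU (inv_one_sub_mul p)
    rw [map_mul, map_one] at this
    have e : serU (1 - PowerSeries.C p * PowerSeries.X) = 1 - P * x := by simp [serU, P, x]
    rw [← e, this]
  have hh : h * (1 - Q * y) = 1 := by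
    have := congrArg serV (inv_one_sub_mul q)
    rw [map_mul, map_one] at this
    have e : serV (1 - PowerSeries.C q * PowerSeries.X) = 1 - Q * y := by simp [serV, Q, y]
    rw [← e, this]
  have e1 : serU (pole p) = x * g := by rw [pole, map_mul]; simp [serU, x, g]
  have e2 : serV (pole q) = y * h := by rw [pole, map_mul]; rfl
  have e3 : (linFactor (p - q) : PowerSeries (PowerSeries ℂ)) = y - x - (P - Q) * (x * y) := by
    rw [linFactor, invUV, ← map_sub, ← map_sub, Algebra.smul_def, PowerSeries.algebraMap_apply,
      PowerSeries.algebraMap_apply]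
    rfl
  rw [e1, e2, e3, invUV]
  linear_combination x * y * y * h * hg - x * y * x * g * hh

theorem commute_of_coeff {R : Type*} [Semiring R] {f g : PowerSeries R}
    (h : ∀ i j, Commute (PowerSeries.coeff i f) (PowerSeries.coeff j g)) : Commute f g := by
  refine PowerSeries.ext fun r => ?_
  rw [PowerSeries.coeff_mul, PowerSeries.coeff_mul, ← Finset.Nat.sum_antidiagonal_swap]
  exact Finset.sum_congr rfl fun p _ => h _ _

theorem exists_vector_algHom {A : Type*} [Ring A] [Algebra ℂ A] (e : Idx S n → Idx S n → A)
    (he : ∀ i j k l, e i j * e k l = if j = k then e i l else 0) (he1 : ∑ p, e p p = 1) (a : ℂ) :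
    ∃ f : X S n →ₐ[ℂ] A, ∀ i j r, f (t i j r) =
      (if i = j ∧ r = 0 then (1 : ℂ) else 0) • 1 - PowerSeries.coeff r (pole a) • e j i
        + (PowerSeries.coeff r (pole (a + kappa S n)) * theta S i j) • e (-i) (-j) := by
  let F : PowerSeries (PowerSeries ℂ) →+* PowerSeries (PowerSeries A) :=
    PowerSeries.map (PowerSeries.map (algebraMap ℂ A))
  -- The poles are treated as scalars: complex double series act centrally on double series over
  -- `A`, so that the computation with matrix units applies.
  let _ : Algebra (PowerSeries (PowerSeries ℂ)) (PowerSeries (PowerSeries A)) :=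
    RingHom.toAlgebra' F fun c x =>
      commute_of_coeff fun i j => commute_of_coeff fun k l => by
        simpa [F] using Algebra.commute_algebraMap_left _ _
  have : IsScalarTower ℂ (PowerSeries (PowerSeries ℂ)) (PowerSeries (PowerSeries A)) := by
    refine IsScalarTower.of_algebraMap_eq fun z => ?_
    change _ = F _
    simp [F, PowerSeries.algebraMap_apply]
  have hF : ∀ z : PowerSeries (PowerSeries ℂ),
    algebraMap (PowerSeries (PowerSeries ℂ)) (PowerSeries (PowerSeries A)) z = F z := fun _ => rfl
  have hsmul : ∀ (c : ℂ) z, F (c • z) = c • F z := by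
    intro c z; simp [F, Algebra.smul_def, PowerSeries.algebraMap_apply]
  have hterm : ∀ z x, z • (PowerSeries.C (PowerSeries.C x)) =
      (F z * PowerSeries.C (PowerSeries.C x) : PowerSeries (PowerSeries A)) := fun z x => by
    rw [Algebra.smul_def, hF]
  let T : Matrix (Idx S n) (Idx S n) (PowerSeries A) := Matrix.of fun i j =>
    PowerSeries.mk fun r => (if i = j ∧ r = 0 then (1 : ℂ) else 0) • 1
      - PowerSeries.coeff r (pole a) • e j i
        + (PowerSeries.coeff r (pole (a + kappa S n)) * theta S i j) • e (-i) (-j)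
  have hT : IsRTT T := by
    constructor
    · intro i j; by_cases h : i = j <;> simp [T, h]
    · have h := vectorMat_rtt (S := S) (n := n) (K := PowerSeries (PowerSeries ℂ))
        (e := fun i j => PowerSeries.C (PowerSeries.C (e i j))) ?_ ?_
        (D := linFactor 0) (w := invUV) (α := serU (pole a)) (β := serU (pole (a + kappa S n)))
        (α' := serV (pole a)) (β' := serV (pole (a + kappa S n))) ?_ ?_ ?_ ?_
      · have e1 : ∀ c : ℂ, F (linFactor c) = linFactor c := by
          intro c
          rw [linFactor, map_sub, map_sub, hsmul]
          simp [linFactor, F, invUV]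
        have e2 : F invUV = invUV := by simp [F, invUV]
        have e3 : linFactor 0 - algebraMap ℂ (PowerSeries (PowerSeries ℂ)) (kappa S n) * invUV =
          linFactor (kappa S n) := by simp [linFactor, Algebra.smul_def]
        rw [hF, hF, hF, map_mul, map_mul, map_mul, e3, e1, e1, e2] at h
        convert h using 1
        · ext i j r s
          have hd : (delta (PowerSeries (PowerSeries ℂ)) i j • 1 : PowerSeries (PowerSeries A)) =
              if i = j then 1 else 0 := by unfold delta; split_ifs <;> simp
          simp only [vectorMat, Matrix.of_apply, Matrix.map_apply, hterm, hd, T, serU, F,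
            PowerSeries.coeff_map, map_sub, map_add, PowerSeries.coeff_mul_C, PowerSeries.coeff_mk,
            PowerSeries.coeff_C, PowerSeries.algebraMap_apply, map_mul, PowerSeries.map_C]
          by_cases hs : s = 0 <;> by_cases hr : r = 0 <;> by_cases hij : i = j <;>
            simp [hs, hr, hij, PowerSeries.coeff_one, Algebra.smul_def]
        · ext i j r s
          have hd : (delta (PowerSeries (PowerSeries ℂ)) i j • 1 : PowerSeries (PowerSeries A)) =
              if i = j then 1 else 0 := by unfold delta; split_ifs <;> simp
          simp only [vectorMat, Matrix.of_apply, Matrix.map_apply, hterm, hd, T, serV, F,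
            map_sub, map_add, PowerSeries.coeff_mul_C, PowerSeries.coeff_C,
            PowerSeries.algebraMap_apply, map_mul, PowerSeries.map_C]
          by_cases hs : s = 0 <;> by_cases hr : r = 0 <;> by_cases hij : i = j <;>
            simp [hs, hr, hij, PowerSeries.coeff_one, Algebra.smul_def]
      · intro i j k l
        rw [← map_mul, ← map_mul, he]
        by_cases h : j = k <;> simp [h, delta]
      · rw [← map_sum, ← map_sum, he1, map_one, map_one]
      · simpa using linFactor_mul_pole a a
      · simpa using linFactor_mul_pole (a + kappa S n) (a + kappa S n)
      · have := linFactor_mul_pole (a + kappa S n) a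
        rw [add_sub_cancel_left] at this
        rw [← this]; simp [linFactor, Algebra.smul_def]
      · have := linFactor_mul_pole a (a + kappa S n)
        rw [sub_add_cancel_left] at this
        rw [← this]; simp [linFactor, Algebra.smul_def]
  obtain ⟨f, hf⟩ := hT.exists_lift
  exact ⟨f, fun i j r => by rw [hf]; simp [T]⟩

end ExtYangian

/-! ### Fermions and the fusion of vector representations into exterior powers. -/

namespace ExtYangian
open ClassicalSeries

variable {S : ClassicalSeries} {n : ℕ}

section Fermions

/-- The fermionic Fock space. -/
abbrev Fock (S : ClassicalSeries) (n : ℕ) : Type := ExteriorAlgebra ℂ (Idx S n → ℂ)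

/-- The creation operators. -/
noncomputable def cre (m : Idx S n) : Fock S n →ₗ[ℂ] Fock S n :=
  LinearMap.mulLeft ℂ (ExteriorAlgebra.ι ℂ (Pi.single m 1))

/-- The annihilation operators. -/
noncomputable def ann (m : Idx S n) : Fock S n →ₗ[ℂ] Fock S n :=
  CliffordAlgebra.contractLeft (LinearMap.proj m)

theorem ann_cre (m l : Idx S n) (w : Fock S n) :
    ann m (cre l w) = (if m = l then w else 0) - cre l (ann m w) := by
  unfold ann cre
  rw [LinearMap.mulLeft_apply, LinearMap.mulLeft_apply]
  refine (CliffordAlgebra.contractLeft_ι_mul _ _ _).trans ?_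
  congr 1
  by_cases h : m = l
  · simp [h]
  · simp [h]

theorem ann_ann (m l : Idx S n) (w : Fock S n) : ann m (ann l w) = -ann l (ann m w) :=
  CliffordAlgebra.contractLeft_comm _ _ _

theorem cre_cre (m l : Idx S n) (w : Fock S n) : cre m (cre l w) = -cre l (cre m w) := by
  unfold cre
  simp only [LinearMap.mulLeft_apply, ← mul_assoc]
  rw [eq_neg_iff_add_eq_zero, ← add_mul]
  rw [ExteriorAlgebra.ι_add_mul_swap, zero_mul]

theorem cre_cre_self (m : Idx S n) (w : Fock S n) : cre m (cre m w) = 0 := by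
  unfold cre
  simp only [LinearMap.mulLeft_apply, ← mul_assoc]
  rw [ExteriorAlgebra.ι_sq_zero, zero_mul]

theorem ann_one (m : Idx S n) : ann m (1 : Fock S n) = 0 :=
  CliffordAlgebra.contractLeft_one (Q := 0) _

/-- The number of fermions of positive label. -/
noncomputable def number (S : ClassicalSeries) (n : ℕ) : Fock S n →ₗ[ℂ] Fock S n :=
  ∑ m : Idx S n with 0 < m.1, cre m ∘ₗ ann m

theorem number_apply (w : Fock S n) :
    number S n w = ∑ m : Idx S n with 0 < m.1, cre m (ann m w) := by
  simp [number]

/-- This makes the count of fermions grow by one with each tensor factor. -/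
theorem ann_number (m : Idx S n) (hm : 0 < m.1) (w : Fock S n) :
    ann m (number S n w) = ann m w + number S n (ann m w) := by
  rw [number_apply, number_apply, map_sum]
  simp only [ann_cre, Finset.sum_sub_distrib]
  rw [Finset.sum_ite_eq, if_pos (by simpa using hm), sub_eq_add_neg, ← Finset.sum_neg_distrib]
  congr 1
  refine Finset.sum_congr rfl fun l _ => ?_
  rw [ann_ann m l, map_neg, neg_neg]

/-- The product of the basis vectors in a list. -/
noncomputable def wedge (L : List (Idx S n)) : Fock S n :=
  L.foldr (fun m w => cre m w) 1

@[simp] theorem wedge_cons (m : Idx S n) (L : List (Idx S n)) :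
    wedge (m :: L) = cre m (wedge L) := rfl

theorem ann_wedge {m : Idx S n} {L : List (Idx S n)} (h : m ∉ L) : ann m (wedge L) = 0 := by
  induction L with
  | nil => exact ann_one m
  | cons l L ih =>
    rw [List.mem_cons, not_or] at h
    rw [wedge_cons, ann_cre, if_neg h.1, ih h.2, map_zero, sub_zero]

theorem cre_wedge {m : Idx S n} {L : List (Idx S n)} (h : m ∈ L) : cre m (wedge L) = 0 := by
  induction L with
  | nil => simp at h
  | cons l L ih =>
    rw [wedge_cons]
    rcases List.mem_cons.1 h with rfl | h
    · exact cre_cre_self _ _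
    · rw [cre_cre, ih h, map_zero, neg_zero]

end Fermions

/-- The multiples of the series `1`. -/
def unitCoeff (r : ℕ) : ℂ := if r = 0 then 1 else 0

/-- A representation of the extended Yangian containing the image of an exterior power of the span
of the basis vectors with positive labels, on which the extended Yangian acts by evaluation. -/
structure Fused {W : Type} [AddCommGroup W] [Module ℂ W] (c : ℂ) (k : ℕ)
    (ρ : X S n →ₐ[ℂ] Module.End ℂ W) (ι : Fock S n →ₗ[ℂ] W) : Prop where
  number : ∀ w, ι (number S n w) = (k : ℂ) • ι w
  pos_pos : ∀ (i j : Idx S n) r w, 0 < i.1 → 0 < j.1 → ρ (t i j r) (ι w) =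
    (if i = j then unitCoeff r else 0) • ι w
      - PowerSeries.coeff r (pole (c + k - 1 - kappa S n)) • ι (cre j (ann i w))
  nonpos_pos : ∀ (i j : Idx S n) r w, i.1 ≤ 0 → 0 < j.1 → ρ (t i j r) (ι w) = 0
  zero_zero : ∀ (i : Idx S n) r w, i.1 = 0 → ρ (t i i r) (ι w) = unitCoeff r • ι w
  neg_zero : ∀ (i j : Idx S n) r w, i.1 < 0 → j.1 = 0 → ρ (t i j r) (ι w) = 0
  neg_neg : ∀ (i j : Idx S n) r w, i.1 < 0 → j.1 < 0 → ρ (t i j r) (ι w) =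
    (if i = j then unitCoeff r else 0) • ι w
      + PowerSeries.coeff r (pole c) • ι (cre (-i) (ann (-j) w))
  wedge_ne_zero : ∀ L : List (Idx S n), L.length = k → L.Nodup → (∀ m ∈ L, 0 < m.1) →
    ι (wedge L) ≠ 0

theorem exists_trivial (S : ClassicalSeries) (n : ℕ) {W : Type} [AddCommGroup W] [Module ℂ W] :
    ∃ ρ : X S n →ₐ[ℂ] Module.End ℂ W, ∀ (i j : Idx S n) r,
      ρ (t i j r) = (if i = j then unitCoeff r else 0) • 1 := by
  obtain ⟨ρ, hρ⟩ := exists_scalar_algHom S n 1 (by simp)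
  refine ⟨(Algebra.ofId ℂ _).comp ρ, fun i j r => ?_⟩
  rw [AlgHom.comp_apply, hρ, PowerSeries.coeff_one, unitCoeff, Algebra.ofId_apply,
    Algebra.algebraMap_eq_smul_one]

theorem commute_algHom {A : Type*} [Ring A] [Algebra ℂ A] (f : X S n →ₐ[ℂ] A) (z : A)
    (h : ∀ i j r, Commute (f (t i j r)) z) (x : X S n) : Commute (f x) z := by
  induction mem_span_monomial x using Submodule.span_induction with
  | mem x hx =>
    obtain ⟨l, rfl⟩ := hx
    induction l with
    | nil => rw [monomial_nil, map_one]; exact Commute.one_left z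
    | cons g l ih => rw [monomial_cons, map_mul]; exact (h _ _ _).mul_left ih
  | zero => rw [map_zero]; exact Commute.zero_left z
  | add x y _ _ hx hy => rw [map_add]; exact hx.add_left hy
  | smul c x _ hx => rw [map_smul]; exact hx.smul_left c

theorem Fused.zero (c : ℂ) : ∃ (ρ : X S n →ₐ[ℂ] Module.End ℂ ℂ) (ι : Fock S n →ₗ[ℂ] ℂ),
    Fused c 0 ρ ι := by
  obtain ⟨ρ, hρ⟩ := exists_trivial S n (W := ℂ)
  have hcre : ∀ (m : Idx S n) w,
      (ExteriorAlgebra.algebraMapInv (R := ℂ) (M := Idx S n → ℂ)).toLinearMap (cre m w) = 0 := by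
    intro m w
    simp [cre, ExteriorAlgebra.algebraMapInv]
  refine ⟨ρ, ExteriorAlgebra.algebraMapInv.toLinearMap, ?_, ?_, ?_, ?_, ?_, ?_, ?_⟩
  · intro w; simp only [number_apply, map_sum, hcre]; simp
  · intro i j r w _ _; rw [hρ, hcre]; split_ifs <;> simp
  · intro i j r w hi hj
    have : i ≠ j := by rintro rfl; omega
    rw [hρ]; simp [this]
  · intro i r w _; rw [hρ]; simp
  · intro i j r w hi hj
    have : i ≠ j := by rintro rfl; omega
    rw [hρ]; simp [this]
  · intro i j r w _ _; rw [hρ, hcre]; split_ifs <;> simp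
  · intro L hL _ _
    rw [List.length_eq_zero_iff] at hL
    subst hL
    simp [wedge]

section Step

variable {W : Type} [AddCommGroup W] [Module ℂ W]

/-- The tensor product of the vector representation with another representation. -/
theorem exists_vector_tensor (ρ : X S n →ₐ[ℂ] Module.End ℂ W) (a : ℂ) :
    ∃ F : X S n →ₐ[ℂ] Module.End ℂ (Idx S n → W), ∀ (i j : Idx S n) r f m,
      F (t i j r) f m = ρ (t i j r) (f m)
        - ∑ p ∈ Finset.HasAntidiagonal.antidiagonal r,
            PowerSeries.coeff p.1 (pole a) • ρ (t m j p.2) (f i)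
        + if m = -i then ∑ l : Idx S n, ∑ p ∈ Finset.HasAntidiagonal.antidiagonal r,
            (PowerSeries.coeff p.1 (pole (a + kappa S n)) * theta S i l) •
              ρ (t l j p.2) (f (-l)) else 0 := by
  let e : Idx S n → Idx S n → Module.End ℂ (Idx S n → W) := fun i j =>
    LinearMap.single ℂ (fun _ => W) i ∘ₗ LinearMap.proj j
  have he' : ∀ i j f m, e i j f m = if m = i then f j else 0 := by
    intro i j f m; simp [e, Pi.single_apply]
  obtain ⟨f₁, hf₁⟩ := exists_vector_algHom e (by
      intro i j k l
      refine LinearMap.ext fun f => funext fun m => ?_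
      rw [Module.End.mul_apply, he', he']
      by_cases h : j = k <;> simp [h, he'])
    (by
      refine LinearMap.ext fun f => funext fun m => ?_
      rw [LinearMap.sum_apply, Finset.sum_apply]
      simp [he']) a
  let g : X S n →ₐ[ℂ] Module.End ℂ (Idx S n → W) := AlgHom.ofLinearMap
    { toFun := fun x => LinearMap.pi fun m => ρ x ∘ₗ LinearMap.proj m
      map_add' := fun x y => by ext; simp
      map_smul' := fun x y => by ext; simp } (by ext; simp) (fun x y => by ext; simp)
  have hg : ∀ x f m, g x f m = ρ x (f m) := fun x f m => rfl
  have hcomm : ∀ x y, Commute (f₁ x) (g y) := by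
    intro x y
    refine commute_algHom f₁ (g y) (fun i j r => ?_) x
    have he : ∀ i j, Commute (e i j) (g y) := by
      intro i j
      refine LinearMap.ext fun f => funext fun m => ?_
      rw [Module.End.mul_apply, Module.End.mul_apply, he', hg, hg, he']
      split_ifs <;> simp
    rw [hf₁]
    exact (((Commute.one_left _).smul_left _).sub_left ((he _ _).smul_left _)).add_left
      ((he _ _).smul_left _)
  obtain ⟨F, hF⟩ := exists_algHom_mul f₁ g hcomm
  refine ⟨F, fun i j r f m => ?_⟩
  rw [hF]
  have : ∀ l p q, (f₁ (t i l p) * g (t l j q)) f m =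
      (if i = l ∧ p = 0 then ρ (t l j q) (f m) else 0)
      - (if m = l then PowerSeries.coeff p (pole a) • ρ (t l j q) (f i) else 0)
      + if m = -i then (PowerSeries.coeff p (pole (a + kappa S n)) * theta S i l) •
          ρ (t l j q) (f (-l)) else 0 := by
    intro l p q
    rw [Module.End.mul_apply, hf₁]
    simp only [LinearMap.add_apply, LinearMap.sub_apply, LinearMap.smul_apply, Pi.add_apply,
      Pi.sub_apply, Pi.smul_apply, he', hg, Module.End.one_apply]
    split_ifs <;> simp
  rw [LinearMap.sum_apply, Finset.sum_apply]
  simp only [LinearMap.sum_apply, Finset.sum_apply, this, Finset.sum_add_distrib,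
    Finset.sum_sub_distrib]
  congr 1
  · congr 1
    · rw [Finset.sum_eq_single i, Finset.sum_eq_single (0, r)]
      · simp
      · rintro ⟨p, q⟩ hp hne
        refine if_neg fun h => hne ?_
        rw [Finset.HasAntidiagonal.mem_antidiagonal] at hp
        ext <;> simp_all
      · simp
      · intro l _ hl
        exact Finset.sum_eq_zero fun p _ => if_neg fun h => hl h.1.symm
      · simp
    · rw [Finset.sum_eq_single m]
      · simp
      · intro l _ hl
        exact Finset.sum_eq_zero fun p _ => if_neg fun h => hl h.symm
      · simp
  · split_ifs <;> simp

/-- The embedding of the Fock space for the next tensor factor. -/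
noncomputable def nextEmbedding (ι : Fock S n →ₗ[ℂ] W) : Fock S n →ₗ[ℂ] (Idx S n → W) :=
  LinearMap.pi fun m => if 0 < m.1 then ι ∘ₗ ann m else 0

theorem nextEmbedding_apply (ι : Fock S n →ₗ[ℂ] W) (w : Fock S n) (m : Idx S n) :
    nextEmbedding ι w m = if 0 < m.1 then ι (ann m w) else 0 := by
  rw [nextEmbedding, LinearMap.pi_apply]
  split_ifs <;> simp

theorem pole_sub_pole (a b : ℂ) : pole a - pole b = PowerSeries.C (a - b) * (pole a * pole b) := by
  have h : ∀ a : ℂ, (1 - PowerSeries.C a * PowerSeries.X : PowerSeries ℂ) ≠ 0 := fun a h => by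
    simpa using congrArg PowerSeries.constantCoeff h
  refine mul_right_cancel₀ (mul_ne_zero (h a) (h b)) ?_
  rw [map_sub]
  linear_combination (1 - PowerSeries.C b * PowerSeries.X
    - (PowerSeries.C a - PowerSeries.C b) * pole b * (1 - PowerSeries.C b * PowerSeries.X))
      * pole_mul a
    - (1 - PowerSeries.C a * PowerSeries.X + (PowerSeries.C a - PowerSeries.C b) * PowerSeries.X)
      * pole_mul b

theorem sum_antidiagonal_coeff_smul (f g : PowerSeries ℂ) (P : Prop) [Decidable P] (r : ℕ)
    (x y : W) : ∑ p ∈ Finset.HasAntidiagonal.antidiagonal r, PowerSeries.coeff p.1 f •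
      ((if P then unitCoeff p.2 else 0) • x + PowerSeries.coeff p.2 g • y) =
      (if P then PowerSeries.coeff r f else 0) • x + PowerSeries.coeff r (f * g) • y := by
  simp only [smul_add, Finset.sum_add_distrib, smul_smul, ← Finset.sum_smul]
  rw [PowerSeries.coeff_mul]
  congr 2
  split_ifs
  · have := PowerSeries.coeff_mul r f 1
    rw [mul_one] at this
    rw [this]
    simp [PowerSeries.coeff_one, unitCoeff]
  · simp

theorem theta_of_neg_neg {i l : Idx S n} (hi : i.1 < 0) (hl : l.1 < 0) : theta S i l = 1 := by
  cases S <;> simp [theta, Int.sign_eq_neg_one_of_neg hi, Int.sign_eq_neg_one_of_neg hl]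

/-- One more vector representation is tensored on the left, and `w` is sent to `∑_{m>0} v_m ⊗ ι(a_m
w)`, where `v_m` are the basis vectors and `a_m` the annihilation operators: the antisymmetric
embedding. With consecutive parameters differing by `1`, the products of poles collapse and the
image is stable under all operators listed in `Fused`. -/
theorem Fused.succ {c : ℂ} {k : ℕ} {ρ : X S n →ₐ[ℂ] Module.End ℂ W} {ι : Fock S n →ₗ[ℂ] W}
    (h : Fused c k ρ ι) : ∃ (F : X S n →ₐ[ℂ] Module.End ℂ (Idx S n → W)),
      Fused c (k + 1) F (nextEmbedding ι) := by
  -- With this parameter the two poles of the new factor are at `c+k-κ`, which is `1` more than the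
  -- pole present on positive labels, and at `c+k`.
  obtain ⟨F, hF⟩ := exists_vector_tensor ρ (c + k - kappa S n)
  rw [sub_add_cancel] at hF
  have hthird : ∀ (i j : Idx S n) r w, 0 ≤ j.1 → (∑ l : Idx S n,
      ∑ p ∈ Finset.HasAntidiagonal.antidiagonal r,
      (PowerSeries.coeff p.1 (pole (c + k)) * theta S i l) •
              ρ (t l j p.2) (nextEmbedding ι w (-l))) = 0 := by
    intro i j r w hj
    refine Finset.sum_eq_zero fun l _ => Finset.sum_eq_zero fun p _ => ?_
    rw [nextEmbedding_apply]
    split_ifs with hl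
    · rw [coe_neg, Left.neg_pos_iff] at hl
      rcases hj.lt_or_eq with hj | hj
      · rw [h.nonpos_pos _ _ _ _ hl.le hj, smul_zero]
      · rw [h.neg_zero _ _ _ _ hl hj.symm, smul_zero]
    · simp
  have hsecond : ∀ (i j m : Idx S n) r w, i.1 ≤ 0 →
      (∑ p ∈ Finset.HasAntidiagonal.antidiagonal r,
        PowerSeries.coeff p.1 (pole (c + k - kappa S n)) •
          ρ (t m j p.2) (nextEmbedding ι w i)) = 0 := by
    intro i j m r w hi
    refine Finset.sum_eq_zero fun p _ => ?_
    rw [nextEmbedding_apply, if_neg (not_lt.2 hi), map_zero, smul_zero]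
  refine ⟨F, ?_, ?_, ?_, ?_, ?_, ?_, ?_⟩
  · intro w
    funext m
    rw [Pi.smul_apply, nextEmbedding_apply, nextEmbedding_apply]
    split_ifs with hm
    · rw [ann_number m hm, map_add, h.number, Nat.cast_add, Nat.cast_one, add_smul, one_smul,
        add_comm]
    · rw [smul_zero]
  · intro i j r w hi hj
    funext m
    rw [hF, hthird _ _ _ _ hj.le, ite_self, add_zero]
    simp only [nextEmbedding_apply, hi, if_true, Pi.sub_apply, Pi.smul_apply]
    have hα : pole (c + ↑(k + 1) - 1 - kappa S n) = pole (c + k - kappa S n) := by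
      congr 1; push_cast; ring
    -- As the poles differ by `1`, the product of the two series is their difference; the old pole
    -- cancels and the new one remains.
    have hpole := pole_sub_pole (c + k - kappa S n) (c + k - 1 - kappa S n)
    rw [show c + k - kappa S n - (c + k - 1 - kappa S n) = 1 by ring, map_one, one_mul,
      sub_eq_iff_eq_add] at hpole
    rw [hα]
    have hp := h.pos_pos
    generalize pole (c + k - kappa S n) = α at hpole ⊢
    generalize pole (c + k - 1 - kappa S n) = y at hpole hp
    by_cases hm : 0 < m.1
    · have hc := congrArg (PowerSeries.coeff r) hpole
      rw [map_add] at hc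
      simp only [if_pos hm, hp i j r _ hi hj, hp m j _ _ hm hj, sub_eq_add_neg,
        ← smul_neg]
      rw [sum_antidiagonal_coeff_smul, ann_cre, ann_ann i m, hc]
      by_cases hmj : m = j
      · simp only [hmj, if_true, map_neg, map_sub]
        module
      · simp only [hmj, if_false, map_neg, map_sub, map_zero]
        module
    · simp only [if_neg hm, h.nonpos_pos m j _ _ (not_lt.1 hm) hj]
      simp
  · intro i j r w hi hj
    funext m
    rw [hF, hthird _ _ _ _ hj.le, ite_self, hsecond _ _ _ _ _ hi, nextEmbedding_apply]
    split_ifs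
    · rw [h.nonpos_pos _ _ _ _ hi hj]; simp
    · simp
  · intro i r w hi
    funext m
    rw [hF, hthird _ _ _ _ hi.ge, ite_self, hsecond _ _ _ _ _ hi.le, Pi.smul_apply,
      nextEmbedding_apply]
    split_ifs
    · rw [h.zero_zero _ _ _ hi]; simp
    · simp
  · intro i j r w hi hj
    funext m
    rw [hF, hthird _ _ _ _ hj.ge, ite_self, hsecond _ _ _ _ _ hi.le, nextEmbedding_apply]
    split_ifs
    · rw [h.neg_zero _ _ _ _ hi hj]; simp
    · simp
  · intro i j r w hi hj
    funext m
    rw [hF, hsecond _ _ _ _ _ hi.le, sub_zero]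
    simp only [nextEmbedding_apply, Pi.add_apply, Pi.smul_apply]
    -- Here the poles differ by `k`, and the factor `k` comes from the number operator in `hnum`:
    -- `pole (c+k) - k · pole (c+k) · pole c = pole c`, so the pole at `c` persists.
    have hpole := pole_sub_pole (c + k) c
    rw [add_sub_cancel_left, ← PowerSeries.smul_eq_C_mul, sub_eq_iff_eq_add'] at hpole
    have hsum : (∑ l : Idx S n, ∑ p ∈ Finset.HasAntidiagonal.antidiagonal r,
        (PowerSeries.coeff p.1 (pole (c + k)) * theta S i l) •
          ρ (t l j p.2) (if 0 < (-l).1 then ι (ann (-l) w) else 0)) =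
        PowerSeries.coeff r (pole c) • ι (ann (-j) w) := by
      have hc := congrArg (PowerSeries.coeff r) hpole
      rw [map_add, map_smul, smul_eq_mul] at hc
      have hl : ∀ l : Idx S n, (∑ p ∈ Finset.HasAntidiagonal.antidiagonal r,
          (PowerSeries.coeff p.1 (pole (c + k)) * theta S i l) •
          ρ (t l j p.2) (if 0 < (-l).1 then ι (ann (-l) w) else 0)) =
          (if l = j then PowerSeries.coeff r (pole (c + k)) • ι (ann (-j) w) else 0) -
          PowerSeries.coeff r (pole (c + k) * pole c) •
            (if 0 < (-l).1 then ι (cre (-l) (ann (-l) (ann (-j) w))) else 0) := by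
        intro l
        split_ifs with h1 h2 h2
        · rw [coe_neg, Left.neg_pos_iff] at h1
          simp only [theta_of_neg_neg hi h1, mul_one, h.neg_neg l j _ _ h1 hj]
          rw [sum_antidiagonal_coeff_smul, if_pos h2, ann_ann (-j), h2]
          simp only [map_neg]
          module
        · rw [coe_neg, Left.neg_pos_iff] at h1
          simp only [theta_of_neg_neg hi h1, mul_one, h.neg_neg l j _ _ h1 hj]
          rw [sum_antidiagonal_coeff_smul, if_neg h2, ann_ann (-j)]
          simp only [map_neg]
          module
        · rw [h2, coe_neg, Left.neg_pos_iff] at h1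
          exact absurd hj h1
        · simp
      rw [Finset.sum_congr rfl fun l _ => hl l, Finset.sum_sub_distrib, Finset.sum_ite_eq',
        if_pos (Finset.mem_univ _), ← Finset.smul_sum]
      have hnum : (∑ l : Idx S n, if 0 < (-l).1 then ι (cre (-l) (ann (-l) (ann (-j) w))) else 0) =
          (k : ℂ) • ι (ann (-j) w) := by
        rw [← h.number, number_apply, map_sum, Finset.sum_filter]
        exact Fintype.sum_equiv (Equiv.neg _) _ _ fun _ => rfl
      rw [hnum, hc]
      module
    rw [hsum]
    by_cases hm : 0 < m.1
    · simp only [if_pos hm, h.neg_neg i j r _ hi hj, ann_cre]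
      by_cases hmi : m = -i
      · simp only [hmi, if_true, map_sub, ann_ann (-i), map_neg]
        module
      · simp only [hmi, if_false, map_sub, ann_ann m, map_neg, map_zero]
        module
    · have hmi : m ≠ -i := by
        rintro rfl
        rw [coe_neg] at hm
        omega
      simp [hm, hmi]
  · intro L hL hnd hpos hzero
    cases L with
    | nil => simp at hL
    | cons s L =>
      have := congrFun hzero s
      rw [nextEmbedding_apply, if_pos (hpos s (by simp)), wedge_cons, ann_cre, if_pos rfl,
        ann_wedge (List.nodup_cons.1 hnd).1, map_zero, sub_zero] at this
      exact h.wedge_ne_zero L (by simpa using hL) (List.nodup_cons.1 hnd).2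
        (fun m hm => hpos m (by simp [hm])) this

end Step

end ExtYangian

/-! ### Highest weights of the exterior powers. -/

namespace ExtYangian
open ClassicalSeries

variable {S : ClassicalSeries} {n : ℕ}

theorem exists_fused (S : ClassicalSeries) (n : ℕ) (c : ℂ) (k : ℕ) :
    ∃ (W : Type) (_ : AddCommGroup W) (_ : Module ℂ W) (ρ : X S n →ₐ[ℂ] Module.End ℂ W)
      (ι : Fock S n →ₗ[ℂ] W), Fused c k ρ ι := by
  induction k with
  | zero =>
    obtain ⟨ρ, ι, h⟩ := Fused.zero (S := S) (n := n) c
    exact ⟨ℂ, _, _, ρ, ι, h⟩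
  | succ k ih =>
    obtain ⟨W, _, _, ρ, ι, h⟩ := ih
    obtain ⟨F, hF⟩ := h.succ
    exact ⟨Idx S n → W, _, _, F, nextEmbedding ι, hF⟩

/-- The tuple `λ(u)` whose components are `f` at the `k` smallest labels, `g` at the `k` largest
labels, and `1` elsewhere. -/
noncomputable def outerTuple (n k : ℕ) (f g : PowerSeries ℂ) (i : ℤ) : PowerSeries ℂ :=
  if (n : ℤ) - k < i then g else if (n : ℤ) - k < -i then f else 1

theorem outerTuple_mul (n k : ℕ) (f g f' g' : PowerSeries ℂ) :
    outerTuple n k f g * outerTuple n k f' g' = outerTuple n k (f * f') (g * g') := by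
  funext i
  simp only [Pi.mul_apply, outerTuple]
  split_ifs <;> simp

theorem outerTuple_one (n k : ℕ) : outerTuple n k 1 1 = fun _ => 1 := by
  funext i
  simp [outerTuple]

theorem card_filter_label {k : ℕ} (hk : k ≤ n) :
    (Finset.univ.filter fun s : Idx S n => (n : ℤ) - k < s.1).card = k := by
  have : (Finset.univ.filter fun s : Idx S n => (n : ℤ) - k < s.1).map
      (Function.Embedding.subtype _) = Finset.Ioc ((n : ℤ) - k) n := by
    ext i
    simp only [Finset.mem_map, Finset.mem_filter, Finset.mem_univ, true_and,
      Function.Embedding.subtype_apply, Subtype.exists, exists_and_left, exists_prop,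
      exists_eq_right_right, Finset.mem_Ioc]
    refine and_congr_right fun h => ?_
    unfold indices
    split_ifs <;> simp <;> omega
  rw [← Finset.card_map (Function.Embedding.subtype _), this]
  simp

/-- The highest vector is the wedge of the `k` largest labels: moving a fermion to a larger label
gives zero, either because the source is empty or because the target is occupied. -/
theorem isHighestWeight_pole (S : ClassicalSeries) {n k : ℕ} (hk : k ≤ n) (c : ℂ) :
    IsHighestWeight S n (outerTuple n k (1 + pole c) (1 - pole (c + k - 1 - kappa S n))) := by
  obtain ⟨W, _, _, ρ, ι, h⟩ := exists_fused S n c k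
  set L := (Finset.univ.filter fun s : Idx S n => (n : ℤ) - k < s.1).toList with hL
  have hmem : ∀ s : Idx S n, s ∈ L ↔ (n : ℤ) - k < s.1 := by simp [hL]
  have hin : ∀ s : Idx S n, (n : ℤ) - k < s.1 → cre s (ann s (wedge L)) = wedge L := by
    intro s hs
    have := ann_cre s s (wedge L)
    rw [cre_wedge ((hmem s).2 hs), map_zero, if_pos rfl] at this
    exact (sub_eq_zero.1 this.symm).symm
  have hout : ∀ s : Idx S n, ¬ (n : ℤ) - k < s.1 → ann s (wedge L) = 0 := fun s hs =>
    ann_wedge (mt (hmem s).1 hs)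
  have hoff : ∀ s s' : Idx S n, s.1 < s'.1 → cre s' (ann s (wedge L)) = 0 := by
    intro s s' hs
    by_cases h1 : (n : ℤ) - k < s.1
    · have := ann_cre s s' (wedge L)
      rwa [cre_wedge ((hmem s').2 (h1.trans hs)), map_zero,
        if_neg (by rintro rfl; exact lt_irrefl _ hs), zero_sub, eq_comm, neg_eq_zero] at this
    · rw [hout s h1, map_zero]
  refine IsHighestWeight.of_module ρ (ι (wedge L)) (h.wedge_ne_zero L ?_ ?_ ?_) ?_ ?_
  · rw [hL, Finset.length_toList, card_filter_label hk]
  · exact Finset.nodup_toList _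
  · intro m hm
    have := (hmem m).1 hm
    omega
  · intro i j r hij
    have hne : i ≠ j := by rintro rfl; exact lt_irrefl _ hij
    rcases lt_trichotomy j.1 0 with hj | hj | hj
    · rw [h.neg_neg i j r _ (hij.trans hj) hj, if_neg hne,
        hoff (-j) (-i) (by rw [coe_neg, coe_neg]; omega)]
      simp
    · exact h.neg_zero i j r _ (by omega) hj
    · rcases le_or_gt i.1 0 with hi | hi
      · exact h.nonpos_pos i j r _ hi hj
      · rw [h.pos_pos i j r _ hi hj, if_neg hne, hoff i j hij]
        simp
  · intro i r
    have hunit : unitCoeff r = PowerSeries.coeff r (1 : PowerSeries ℂ) := by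
      rw [PowerSeries.coeff_one, unitCoeff]
    have hkn : (0 : ℤ) ≤ n - k := by omega
    rcases lt_trichotomy i.1 0 with hi | hi | hi
    · rw [h.neg_neg i i r _ hi hi, if_pos rfl, hunit, outerTuple, if_neg (by omega)]
      split_ifs with h1
      · rw [hin (-i) (by simpa using h1), map_add, add_smul]
      · rw [hout (-i) (by simpa using h1)]; simp
    · rw [h.zero_zero i r _ hi, hunit, outerTuple, if_neg (by omega), if_neg (by omega)]
    · rw [h.pos_pos i i r _ hi hi, if_pos rfl, hunit, outerTuple]
      split_ifs with h1 h2
      · rw [hin i h1, map_sub, sub_smul]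
      · omega
      · rw [hout i h1]; simp

end ExtYangian

/-! ### Shifts of series and the tuples built from a polynomial `f`. -/

namespace ExtYangian
open ClassicalSeries

variable {S : ClassicalSeries} {n : ℕ}

section Shift

open PowerSeries (constantCoeff coeff)

theorem hasSubst_shift (a : ℂ) :
    PowerSeries.HasSubst (PowerSeries.X * (1 + PowerSeries.C a * PowerSeries.X)⁻¹ : PowerSeries ℂ) :=
  PowerSeries.HasSubst.of_constantCoeff_zero' (by simp)

theorem shift_mul (a : ℂ) (f g : PowerSeries ℂ) : shift a (f * g) = shift a f * shift a g :=
  PowerSeries.subst_mul (hasSubst_shift a) f g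

theorem shift_add (a : ℂ) (f g : PowerSeries ℂ) : shift a (f + g) = shift a f + shift a g :=
  PowerSeries.subst_add (hasSubst_shift a) f g

theorem shift_C (a b : ℂ) : shift a (PowerSeries.C b) = PowerSeries.C b := PowerSeries.subst_C b

theorem shift_one (a : ℂ) : shift a 1 = 1 := by
  rw [← map_one PowerSeries.C, shift_C]

theorem shift_X (a : ℂ) : shift a PowerSeries.X = PowerSeries.X * (1 + PowerSeries.C a * PowerSeries.X)⁻¹ :=
  PowerSeries.subst_X (hasSubst_shift a)

theorem shift_X_mul (a : ℂ) : shift a PowerSeries.X * (1 + PowerSeries.C a * PowerSeries.X) = PowerSeries.X := by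
  rw [shift_X, mul_assoc, PowerSeries.inv_mul_cancel _ (by simp), mul_one]

theorem shift_eq_C_add (a : ℂ) (f : PowerSeries ℂ) : ∃ g, f = PowerSeries.C (constantCoeff f) + PowerSeries.X * g ∧
    shift a f = PowerSeries.C (constantCoeff f) + shift a PowerSeries.X * shift a g := by
  refine ⟨PowerSeries.mk fun p => coeff (p + 1) f, ?_, ?_⟩
  · rw [add_comm]; exact PowerSeries.eq_X_mul_shift_add_const f
  · conv_lhs => rw [PowerSeries.eq_X_mul_shift_add_const f]
    rw [shift_add, shift_mul, shift_C, add_comm]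

theorem constantCoeff_shift (a : ℂ) (f : PowerSeries ℂ) :
    constantCoeff (shift a f) = constantCoeff f := by
  obtain ⟨g, -, h⟩ := shift_eq_C_add a f
  rw [h, shift_X]
  simp

theorem inv_one_add_C_mul_X (a : ℂ) :
    (1 + PowerSeries.C a * PowerSeries.X : PowerSeries ℂ)⁻¹ = PowerSeries.mk fun r => (-a) ^ r := by
  rw [PowerSeries.inv_eq_iff_mul_eq_one (by simp)]
  ext r
  rw [mul_add, mul_one, map_add, mul_left_comm, PowerSeries.coeff_C_mul, PowerSeries.coeff_one]
  cases r with
  | zero => simp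
  | succ r =>
    rw [PowerSeries.coeff_succ_mul_X, PowerSeries.coeff_mk, PowerSeries.coeff_mk]
    simp [pow_succ]
    ring

end Shift

open PowerSeries (constantCoeff coeff)

/-- The tuple with `f(u)` at the `k` smallest labels and `f(u+κ-k)⁻¹` at the `k` largest labels. -/
noncomputable def dualTuple (S : ClassicalSeries) (n k : ℕ) (f : PowerSeries ℂ) :
    ℤ → PowerSeries ℂ :=
  outerTuple n k f (shift (kappa S n - k) f)⁻¹

theorem dualTuple_mul (n k : ℕ) (f g : PowerSeries ℂ) :
    dualTuple S n k (f * g) = dualTuple S n k f * dualTuple S n k g := by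
  rw [dualTuple, dualTuple, dualTuple, outerTuple_mul, shift_mul, PowerSeries.mul_inv_rev,
    mul_comm (shift _ g)⁻¹]

theorem dualTuple_one (n k : ℕ) : dualTuple S n k 1 = fun _ => 1 := by
  have h : (1 : PowerSeries ℂ)⁻¹ = 1 := by
    rw [PowerSeries.inv_eq_iff_mul_eq_one (by simp), one_mul]
  rw [dualTuple, shift_one, h, outerTuple_one]

/-- A telescoping product of the weights of exterior powers at `c = 0, -1, …, -(m-1)`: at the
smallest labels the factor is `1 + 1/(u+m) = (u+m+1)/(u+m)`, and at the largest labels it is the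
inverse of this, shifted by `κ-k`. -/
theorem isHighestWeight_dualTuple_natCast (S : ClassicalSeries) {n k : ℕ} (hk : k ≤ n) (m : ℕ) :
    IsHighestWeight S n (dualTuple S n k (1 + PowerSeries.C (m : ℂ) * PowerSeries.X)) := by
  induction m with
  | zero => simpa [dualTuple_one] using isHighestWeight_scalar S n 1 (by simp)
  | succ m ih =>
    have h := ih.mul (isHighestWeight_pole S hk (-m))
    rw [dualTuple, outerTuple_mul] at h
    convert h using 1
    have h1 := pole_mul (-m)
    have h2 := pole_mul (-m + k - 1 - kappa S n)
    generalize pole (-m : ℂ) = P at h1 ⊢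
    generalize pole (-m + k - 1 - kappa S n) = Q at h2 ⊢
    have h3 := shift_X_mul (kappa S n - k)
    rw [dualTuple]
    congr 1
    · simp only [map_neg, Nat.cast_add, Nat.cast_one, map_add, map_one] at h1 ⊢
      linear_combination -h1
    · simp only [shift_add, shift_mul, shift_one, shift_C]
      have hc : constantCoeff (shift (kappa S n - k) PowerSeries.X) = 0 := by simp [constantCoeff_shift]
      generalize shift (kappa S n - k) PowerSeries.X = Z at h3 hc ⊢
      rw [PowerSeries.inv_eq_iff_mul_eq_one (by simp [hc])]
      have h4 : (1 + PowerSeries.C (m : ℂ) * Z)⁻¹ * (1 + PowerSeries.C (m : ℂ) * Z) = 1 :=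
        PowerSeries.inv_mul_cancel _ (by simp [hc])
      have h5 : (1 - Q) * (1 + PowerSeries.C ((m + 1 : ℕ) : ℂ) * Z) = 1 + PowerSeries.C (m : ℂ) * Z := by
        have hne : ∀ a : ℂ, (1 - PowerSeries.C a * PowerSeries.X : PowerSeries ℂ) ≠ 0 := fun a h => by
          simpa using congrArg constantCoeff h
        have hne' : ∀ a : ℂ, (1 + PowerSeries.C a * PowerSeries.X : PowerSeries ℂ) ≠ 0 := fun a h => by
          simpa using congrArg constantCoeff h
        refine mul_right_cancel₀ (mul_ne_zero (hne (-m + k - 1 - kappa S n))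
          (hne' (kappa S n - k))) ?_
        simp only [map_neg, map_sub, Nat.cast_add, Nat.cast_one, map_add, map_one] at h2 h3 ⊢
        generalize PowerSeries.C (m : ℂ) = M at h2 h3 ⊢
        generalize PowerSeries.C (k : ℂ) = K at h2 h3 ⊢
        generalize PowerSeries.C (kappa S n) = κ at h2 h3 ⊢
        linear_combination -((1 + (κ - K) * PowerSeries.X) + (M + 1) * Z * (1 + (κ - K) * PowerSeries.X)) * h2
          + ((1 - (-M + K - 1 - κ) * PowerSeries.X - PowerSeries.X) * (M + 1) - (1 - (-M + K - 1 - κ) * PowerSeries.X) * M) * h3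
      rw [mul_assoc, h5, h4]

/-- Interpolation from natural to complex `c`; the point is that every coefficient of the tuple is
polynomial in `c`. -/
theorem isHighestWeight_dualTuple_linear (S : ClassicalSeries) {n k : ℕ} (hk : k ≤ n) (c : ℂ) :
    IsHighestWeight S n (dualTuple S n k (1 + PowerSeries.C c * PowerSeries.X)) := by
  refine IsHighestWeight.of_forall_nat
    (fun c => dualTuple S n k (1 + PowerSeries.C c * PowerSeries.X)) ?_
    (isHighestWeight_dualTuple_natCast S hk) c
  intro i r
  simp only [dualTuple, outerTuple]
  split_ifs
  · set s := kappa S n - k with hs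
    -- With `x = u⁻¹`, the inverse of `1 + c x/(1+sx)` is `(1+sx)/(1+(c+s)x)`, a geometric series in
    -- `-(c+s)x` times `1+sx`.
    have h : ∀ c : ℂ, (shift s (1 + PowerSeries.C c * PowerSeries.X))⁻¹ =
        (PowerSeries.mk fun r => (-(c + s)) ^ r) * (1 + PowerSeries.C s * PowerSeries.X) := by
      intro c
      have h3 := shift_X_mul s
      have h4 := PowerSeries.mul_inv_cancel
        (1 + PowerSeries.C (c + s) * PowerSeries.X : PowerSeries ℂ) (by simp)
      rw [PowerSeries.inv_eq_iff_mul_eq_one (by simp [constantCoeff_shift]),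
        ← inv_one_add_C_mul_X, shift_add, shift_mul, shift_C, shift_one]
      rw [map_add] at h4 ⊢
      linear_combination h4 + PowerSeries.C c *
        (1 + (PowerSeries.C c + PowerSeries.C s) * PowerSeries.X)⁻¹ * h3
    cases r with
    | zero => exact ⟨1, fun c => by rw [h]; simp⟩
    | succ r =>
      refine ⟨(-(Polynomial.X + Polynomial.C s)) ^ (r + 1)
        + Polynomial.C s * (-(Polynomial.X + Polynomial.C s)) ^ r, fun c => ?_⟩
      rw [h, mul_add, mul_one, map_add, mul_left_comm, PowerSeries.coeff_C_mul,
        PowerSeries.coeff_succ_mul_X, PowerSeries.coeff_mk, PowerSeries.coeff_mk]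
      simp
  · refine ⟨Polynomial.C (coeff r 1) + Polynomial.X * Polynomial.C (coeff r PowerSeries.X),
      fun c => ?_⟩
    rw [Polynomial.eval_add, Polynomial.eval_C, Polynomial.eval_mul, Polynomial.eval_X,
      Polynomial.eval_C, map_add, PowerSeries.coeff_C_mul]
  · exact ⟨Polynomial.C (coeff r 1), fun c => by rw [Polynomial.eval_C]⟩

/-- A complex polynomial with constant term `1` is a product of factors `1 - r⁻¹ X` over its roots
`r`, which are nonzero. -/
theorem isHighestWeight_dualTuple (S : ClassicalSeries) {n k : ℕ} (hk : k ≤ n)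
    (p : Polynomial ℂ) (hp : p.coeff 0 = 1) :
    IsHighestWeight S n (dualTuple S n k (p : PowerSeries ℂ)) := by
  induction hd : p.natDegree using Nat.strong_induction_on generalizing p with
  | _ d ih =>
  subst hd
  by_cases h0 : p.natDegree = 0
  · rw [Polynomial.eq_C_of_natDegree_eq_zero h0, hp, map_one, Polynomial.coe_one, dualTuple_one]
    exact isHighestWeight_scalar S n 1 (by simp)
  · obtain ⟨r, hr⟩ := IsAlgClosed.exists_root p
      (fun h => h0 (Polynomial.natDegree_eq_zero_iff_degree_le_zero.2 h.le))
    have hr0 : r ≠ 0 := by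
      rintro rfl
      rw [Polynomial.IsRoot, ← Polynomial.coeff_zero_eq_eval_zero, hp] at hr
      exact one_ne_zero hr
    have hq := Polynomial.mul_divByMonic_eq_iff_isRoot.2 hr
    set q := p /ₘ (Polynomial.X - Polynomial.C r)
    have hdeg : q.natDegree < p.natDegree := by
      have hq0 : q ≠ 0 := fun h => by
        rw [h, mul_zero] at hq
        rw [← hq] at hp
        simp at hp
      rw [← hq, (Polynomial.monic_X_sub_C r).natDegree_mul' hq0, Polynomial.natDegree_X_sub_C]
      omega
    have hpq : p = (1 + Polynomial.C (-r⁻¹) * Polynomial.X) * (Polynomial.C (-r) * q) := by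
      rw [← hq]
      have : Polynomial.C (r⁻¹) * Polynomial.C r = (1 : Polynomial ℂ) := by
        rw [← map_mul, inv_mul_cancel₀ hr0, map_one]
      rw [map_neg, map_neg]
      linear_combination -Polynomial.X * q * this
    have hq0 : (Polynomial.C (-r) * q).coeff 0 = 1 := by
      rw [hpq, Polynomial.mul_coeff_zero] at hp
      simpa using hp
    have hlt : (Polynomial.C (-r) * q).natDegree < p.natDegree :=
      (Polynomial.natDegree_C_mul_le _ _).trans_lt hdeg
    have := (isHighestWeight_dualTuple_linear S hk (-r⁻¹)).mul (ih _ hlt _ hq0 rfl)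
    rw [← dualTuple_mul] at this
    rw [hpq]
    simpa using this

end ExtYangian

/-! ### Necessity: the recursion for matrix elements and its solution. -/

namespace ExtYangian
open ClassicalSeries
open PowerSeries (constantCoeff coeff)

variable {S : ClassicalSeries} {n : ℕ}

section Recursion

variable {ι R : Type*} [LinearOrder ι] [Fintype ι] [CommRing R] [IsDomain R]
  {D w : R} {a Z W : ι → R} {P : ι → Prop}

/-- Once `Z = W` below `i`, the difference of the two equations reads `(D + m w)(Z_i - W_i) = 0`,
where `m` counts the indices below `i`. -/
theorem eq_of_recursion (hP : ∀ i j, i < j → P j → P i)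
    (hZ : ∀ i, P i → D * (Z i - a i) = -(w * ∑ p with p < i, (Z i - W p)))
    (hW : ∀ i, P i → D * (W i - a i) = w * ∑ p with p < i, (Z p - W i))
    (hD : ∀ m : ℕ, D + m * w ≠ 0) : ∀ i, P i → Z i = W i := by
  intro i
  induction i using WellFoundedLT.induction with
  | _ i ih =>
  intro hi
  have h1 := hZ i hi
  have h2 := hW i hi
  have h3 : ∑ p with p < i, Z p = ∑ p with p < i, W p :=
    Finset.sum_congr rfl fun p hp => ih p (Finset.mem_filter.1 hp).2
      (hP p i (Finset.mem_filter.1 hp).2 hi)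
  rw [Finset.sum_sub_distrib, Finset.sum_const, nsmul_eq_mul] at h1 h2
  refine mul_left_cancel₀ (hD (Finset.card {p | p < i})) ?_
  linear_combination h1 - h2 - w * h3

/-- The equations for `Z_j` and `Z_i` are subtracted. Their sums differ only by the term with `W_i`,
which equals `Z_i`. -/
theorem consecutive_of_recursion (hP : ∀ i j, i < j → P j → P i)
    (hZ : ∀ i, P i → D * (Z i - a i) = -(w * ∑ p with p < i, (Z i - W p)))
    (hW : ∀ i, P i → D * (W i - a i) = w * ∑ p with p < i, (Z p - W i))
    (hD : ∀ m : ℕ, D + m * w ≠ 0) {i j : ι} (hij : ∀ p, p < j ↔ p ≤ i) (hj : P j) :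
    (D + (Finset.card {p | p < j} : ℕ) * w) * (Z j - Z i) = D * (a j - a i) := by
  have hi : P i := hP i j ((hij i).2 le_rfl) hj
  have h1 := hZ i hi
  have h2 := hZ j hj
  have h3 := eq_of_recursion hP hZ hW hD i hi
  have h4 : (Finset.univ.filter fun p => p < j) = insert i (Finset.univ.filter fun p => p < i) := by
    ext p
    simp [hij, le_iff_eq_or_lt]
  rw [Finset.sum_sub_distrib, Finset.sum_const, nsmul_eq_mul] at h1 h2
  rw [h4, Finset.sum_insert (by simp), Finset.card_insert_of_notMem (by simp)] at h2
  rw [h4, Finset.card_insert_of_notMem (by simp)]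
  push_cast at h2 ⊢
  linear_combination h2 - h1 - w * h3

end Recursion

section Functional

/-- The application of a functional to all coefficients of a series. -/
noncomputable def mapCoeff (φ : X S n →ₗ[ℂ] ℂ) :
    PowerSeries (PowerSeries (X S n)) →ₗ[ℂ] PowerSeries (PowerSeries ℂ) where
  toFun F := PowerSeries.mk fun r => PowerSeries.mk fun s => φ (coeff s (coeff r F))
  map_add' F G := by ext; simp
  map_smul' c F := by ext; simp

theorem intCoeff₂_mapCoeff (φ : X S n →ₗ[ℂ] ℂ) (F : PowerSeries (PowerSeries (X S n))) (r s : ℤ) :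
    intCoeff₂ (mapCoeff φ F) r s = φ (intCoeff₂ F r s) := by
  unfold intCoeff₂ intCoeff
  split_ifs <;> simp [mapCoeff]

theorem mapCoeff_linFactor_mul (φ : X S n →ₗ[ℂ] ℂ) (a : ℂ)
    (F : PowerSeries (PowerSeries (X S n))) :
    mapCoeff φ (linFactor a * F) = linFactor a * mapCoeff φ F := by
  refine intCoeff₂_ext fun r s => ?_
  simp only [intCoeff₂_mapCoeff, intCoeff₂_linFactor_mul, mulUSubVSub, map_sub, map_smul]

theorem mapCoeff_invUV_mul (φ : X S n →ₗ[ℂ] ℂ) (F : PowerSeries (PowerSeries (X S n))) :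
    mapCoeff φ (invUV * F) = invUV * mapCoeff φ F := by
  refine intCoeff₂_ext fun r s => ?_
  simp only [intCoeff₂_mapCoeff, intCoeff₂_invUV_mul]

theorem linFactor_ne_zero (a : ℂ) : (linFactor a : PowerSeries (PowerSeries ℂ)) ≠ 0 := by
  intro h
  have := congrArg (fun F => coeff 1 (coeff 0 F)) h
  simp [linFactor, invUV] at this

theorem linFactor_add_natCast_mul (a : ℂ) (m : ℕ) :
    (linFactor a + (m : PowerSeries (PowerSeries ℂ)) * invUV) = linFactor (a - m) := by
  rw [linFactor, linFactor, sub_smul, Nat.cast_smul_eq_nsmul, nsmul_eq_mul]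
  ring

variable {lam : ℤ → PowerSeries ℂ} {φ : X S n →ₗ[ℂ] ℂ}

theorem IsHighestWeightFunctional.map_raising (h : IsHighestWeightFunctional lam φ)
    (f : PowerSeries (X S n)) {k l : Idx S n} (hkl : k.1 < l.1) :
    mapCoeff φ (serU f * serV (tMat S n k l)) = 0 ∧
      mapCoeff φ (serV f * serU (tMat S n k l)) = 0 := by
  constructor <;> refine intCoeff₂_ext fun r s => ?_
  · rw [intCoeff₂_mapCoeff, intCoeff₂_serU_mul_serV, intCoeff₂_zero, intCoeff, intCoeff]
    split_ifs <;> simp [h.map_mul_raising _ _ _ _ hkl]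
  · rw [intCoeff₂_mapCoeff, intCoeff₂_serV_mul_serU, intCoeff₂_zero, intCoeff, intCoeff]
    split_ifs <;> simp [h.map_mul_raising _ _ _ _ hkl]

theorem IsHighestWeightFunctional.map_diag (h : IsHighestWeightFunctional lam φ)
    (i k : Idx S n) :
    mapCoeff φ (serU (tMat S n i i) * serV (tMat S n k k)) = serU (lam i.1) * serV (lam k.1) ∧
      mapCoeff φ (serV (tMat S n k k) * serU (tMat S n i i)) =
        serU (lam i.1) * serV (lam k.1) := by
  have hone : ∀ (i : Idx S n) r, φ (t i i r) = coeff r (lam i.1) := fun i r => by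
    have := h.map_mul_diag 1 i r
    rwa [one_mul, h.map_one, mul_one] at this
  constructor <;> refine intCoeff₂_ext fun r s => ?_
  · rw [intCoeff₂_mapCoeff, intCoeff₂_serU_mul_serV, intCoeff₂_serU_mul_serV]
    simp only [intCoeff]
    split_ifs <;> simp [h.map_mul_diag, hone, mul_comm]
  · rw [intCoeff₂_mapCoeff, intCoeff₂_serV_mul_serU, intCoeff₂_serU_mul_serV]
    simp only [intCoeff]
    split_ifs <;> simp [h.map_mul_diag, hone]

/-- Since `p < -q`, both products coming from the permutation operator end in the raising series
`t_{p,-q}` and are killed by `φ`. The common factor `u - v` then cancels. -/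
theorem IsHighestWeightFunctional.map_commutator (h : IsHighestWeightFunctional lam φ)
    {p q : Idx S n} (hpq : p.1 + q.1 < 0) :
    linFactor (kappa S n) * (mapCoeff φ (serU (tMat S n p q) * serV (tMat S n (-p) (-q)))
      - mapCoeff φ (serV (tMat S n (-p) (-q)) * serU (tMat S n p q))) =
    -(invUV * ((∑ r : Idx S n, theta S p r •
        mapCoeff φ (serU (tMat S n r q) * serV (tMat S n (-r) (-q))))
      - ∑ r : Idx S n, theta S q r •
        mapCoeff φ (serV (tMat S n (-p) (-r)) * serU (tMat S n p r)))) := by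
  have hrel := congrArg (mapCoeff φ) ((tMat_isRTT S n).rtt p q (-p) (-q))
  have hlt : p.1 < (-q).1 := by rw [coe_neg]; omega
  simp only [Matrix.map_apply, if_true, map_sub, mul_assoc, mapCoeff_linFactor_mul,
    mapCoeff_invUV_mul, map_sum, map_smul, (h.map_raising _ hlt).1, (h.map_raising _ hlt).2] at hrel
  refine mul_left_cancel₀ (linFactor_ne_zero 0) ?_
  linear_combination hrel

theorem theta_self (i : Idx S n) : theta S i i = 1 := by
  cases S
  · rfl
  · have := ne_zero_of_mem_indices (by simp) i
    rcases lt_or_gt_of_ne this with h | h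
    · exact theta_of_neg_neg h h
    · simp [theta, Int.sign_eq_one_of_pos h]
  · rfl

/-- With `c` and `d` the values of `φ` on the two orders of the factors, `c p i` vanishes for `i <
p` and `d p i` for `p < i`, each product ending in a raising series. So for `p < i ≤ 0` the
commutator relation has a single unknown on its left; summing over `p` with the signs `θ` gives the
system. -/
theorem IsHighestWeightFunctional.exists_recursion (h : IsHighestWeightFunctional lam φ) :
    ∃ Z W : Idx S n → PowerSeries (PowerSeries ℂ), ∀ i : Idx S n, i.1 ≤ 0 →
      linFactor (kappa S n) * (Z i - serU (lam i.1) * serV (lam (-i.1))) =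
        -(invUV * ∑ p with p < i, (Z i - W p)) ∧
      linFactor (kappa S n) * (W i - serU (lam i.1) * serV (lam (-i.1))) =
        invUV * ∑ p with p < i, (Z p - W i) := by
  have hcomm := fun p q : Idx S n => h.map_commutator (p := p) (q := q)
  set c := fun p q : Idx S n => mapCoeff φ (serU (tMat S n p q) * serV (tMat S n (-p) (-q))) with hc
  set d := fun p q : Idx S n => mapCoeff φ (serV (tMat S n (-p) (-q)) * serU (tMat S n p q)) with hd
  have hcomm' : ∀ p q : Idx S n, p.1 + q.1 < 0 → linFactor (kappa S n) * (c p q - d p q) =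
      -(invUV * (∑ r : Idx S n, theta S p r • c r q - ∑ r : Idx S n, theta S q r • d p r)) := hcomm
  have hc0 : ∀ p i : Idx S n, i < p → c p i = 0 := fun p i hp =>
    (h.map_raising _ (by simpa using hp)).1
  have hd0 : ∀ p i : Idx S n, p < i → d p i = 0 := fun p i hp => (h.map_raising _ hp).2
  have hci : ∀ i : Idx S n, c i i = serU (lam i.1) * serV (lam (-i.1)) := fun i =>
    (h.map_diag i (-i)).1
  have hdi : ∀ i : Idx S n, d i i = serU (lam i.1) * serV (lam (-i.1)) := fun i =>
    (h.map_diag i (-i)).2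
  clear_value c d
  clear hcomm
  -- By multiplicativity of `θ`, the two sums in the relation depend, up to the common sign
  -- `θ_{ip}`, on `i` alone and on `p` alone: they are `Z i` and `W p`.
  have hsmul : ∀ i p : Idx S n, theta S i p •
      (∑ r : Idx S n, theta S p r • c r i - ∑ r : Idx S n, theta S i r • d p r) =
      ∑ r : Idx S n, theta S i r • c r i - ∑ r : Idx S n, theta S p r • d p r := by
    intro i p
    simp only [smul_sub, Finset.smul_sum, smul_smul, theta_mul_theta]
    rw [theta_comm]
    simp only [theta_mul_theta]
  have hsplit : ∀ (i : Idx S n) (f : Idx S n → PowerSeries (PowerSeries ℂ)),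
      (∀ p, i < p → f p = 0) → 
      ∑ p : Idx S n, theta S i p • f p = f i + ∑ p : Idx S n with p < i, theta S i p • f p := by
    intro i f hf
    rw [← Finset.sum_filter_add_sum_filter_not Finset.univ (fun p => p < i)
      (fun p => theta S i p • f p), add_comm]
    congr 1
    rw [Finset.sum_eq_single_of_mem i (by simp), theta_self, one_smul]
    intro p hp hpi
    rw [hf p (lt_of_le_of_ne (by simpa using hp) (Ne.symm hpi)), smul_zero]
  refine ⟨fun i => ∑ p : Idx S n, theta S i p • c p i,
    fun p => ∑ q : Idx S n, theta S p q • d p q, fun i hi => ⟨?_, ?_⟩⟩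
  · have e : ∑ p : Idx S n, theta S i p • c p i - serU (lam i.1) * serV (lam (-i.1)) =
        ∑ p : Idx S n with p < i, theta S i p • c p i := by
      rw [hsplit i (fun p => c p i) fun p hp => hc0 p i hp, hci, add_sub_cancel_left]
    beta_reduce
    rw [e, Finset.mul_sum, Finset.mul_sum, ← Finset.sum_neg_distrib]
    refine Finset.sum_congr rfl fun p hp => ?_
    have hp : p.1 < i.1 := (Finset.mem_filter.1 hp).2
    have := hcomm' p i (by omega)
    rw [hd0 p i hp, sub_zero] at this
    rw [← hsmul i p, mul_smul_comm, mul_smul_comm, ← smul_neg, this]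
  · have e : ∑ p : Idx S n, theta S i p • d i p - serU (lam i.1) * serV (lam (-i.1)) =
        ∑ p : Idx S n with p < i, theta S i p • d i p := by
      rw [hsplit i (fun q => d i q) fun p hp => hd0 i p hp, hdi, add_sub_cancel_left]
    beta_reduce
    rw [e, Finset.mul_sum, Finset.mul_sum]
    refine Finset.sum_congr rfl fun p hp => ?_
    have hp : p.1 < i.1 := (Finset.mem_filter.1 hp).2
    have := hcomm' i p (by omega)
    rw [hc0 i p hp, zero_sub, mul_neg, neg_inj] at this
    rw [← hsmul p i, mul_smul_comm, mul_smul_comm, this, theta_comm]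

end Functional

/-! ### Substitution of `u = v + a` into a double series. -/

section Evaluation

/-- The substitution of a series `g` in `v⁻¹` without constant term for `u⁻¹`. -/
noncomputable def evalU (g : PowerSeries ℂ) (F : PowerSeries (PowerSeries ℂ)) : PowerSeries ℂ :=
  PowerSeries.mk fun N => coeff N (∑ r ∈ Finset.range (N + 1), coeff r F * g ^ r)

theorem X_pow_dvd_evalU_sub {g : PowerSeries ℂ} (hg : constantCoeff g = 0)
    (F : PowerSeries (PowerSeries ℂ)) (M : ℕ) :
    PowerSeries.X ^ M ∣ evalU g F - ∑ r ∈ Finset.range M, coeff r F * g ^ r := by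
  rw [PowerSeries.X_pow_dvd_iff]
  intro N hN
  rw [map_sub, evalU, PowerSeries.coeff_mk, sub_eq_zero, map_sum, map_sum]
  refine Finset.sum_subset (Finset.range_subset_range.2 hN) fun r _ hr => ?_
  have h1 : PowerSeries.X ^ r ∣ coeff r F * g ^ r :=
    (pow_dvd_pow_of_dvd (PowerSeries.X_dvd_iff.2 hg) r).mul_left _
  exact PowerSeries.X_pow_dvd_iff.1 h1 N (by simpa using hr)

/-- The substituted series is characterised by its congruences modulo powers of `v⁻¹`, which reduces
its algebraic rules to finite sums. -/
theorem eq_evalU {g f : PowerSeries ℂ} (hg : constantCoeff g = 0)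
    (F : PowerSeries (PowerSeries ℂ))
    (h : ∀ M, PowerSeries.X ^ M ∣ f - ∑ r ∈ Finset.range M, coeff r F * g ^ r) :
    f = evalU g F := by
  rw [← sub_eq_zero]
  ext N
  have := dvd_sub (h (N + 1)) (X_pow_dvd_evalU_sub hg F (N + 1))
  rw [sub_sub_sub_cancel_right] at this
  exact PowerSeries.X_pow_dvd_iff.1 this N N.lt_succ_self

theorem evalU_sub (g : PowerSeries ℂ) (F G : PowerSeries (PowerSeries ℂ)) :
    evalU g (F - G) = evalU g F - evalU g G := by
  ext N
  simp [evalU, sub_mul, Finset.sum_sub_distrib]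

theorem evalU_C_mul {g : PowerSeries ℂ} (hg : constantCoeff g = 0) (h : PowerSeries ℂ)
    (F : PowerSeries (PowerSeries ℂ)) :
    evalU g (PowerSeries.C h * F) = h * evalU g F := by
  refine (eq_evalU hg _ fun M => ?_).symm
  simp only [PowerSeries.coeff_C_mul, mul_assoc, ← Finset.mul_sum, ← mul_sub]
  exact (X_pow_dvd_evalU_sub hg F M).mul_left _

theorem evalU_X_mul {g : PowerSeries ℂ} (hg : constantCoeff g = 0)
    (F : PowerSeries (PowerSeries ℂ)) :
    evalU g (PowerSeries.X * F) = g * evalU g F := by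
  refine (eq_evalU hg _ fun M => ?_).symm
  cases M with
  | zero => simp
  | succ M =>
    rw [Finset.sum_range_succ']
    simp only [PowerSeries.coeff_succ_X_mul, PowerSeries.coeff_zero_X_mul, zero_mul, add_zero,
      pow_succ', mul_left_comm _ g, ← Finset.mul_sum, ← mul_sub]
    exact mul_dvd_mul (PowerSeries.X_dvd_iff.2 hg) (X_pow_dvd_evalU_sub hg F M)

theorem evalU_serU (a : ℂ) (f : PowerSeries ℂ) : evalU (shift a PowerSeries.X) (serU f) =
    shift a f := by
  have hg : constantCoeff (shift a PowerSeries.X) = 0 := by simp [constantCoeff_shift]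
  refine (eq_evalU hg _ fun M => ?_).symm
  induction M generalizing f with
  | zero => simp
  | succ M ih =>
    obtain ⟨g, hf, hs⟩ := shift_eq_C_add a f
    have hsucc : ∀ r, coeff (r + 1) f = coeff r g := fun r => by
      rw [hf]; simp [PowerSeries.coeff_succ_X_mul]
    have h0 : ∀ (f : PowerSeries ℂ) r, coeff r (serU f) = PowerSeries.C (coeff r f) := fun f r => by
      simp [serU]
    rw [Finset.sum_range_succ', hs]
    simp only [h0, hsucc, pow_zero, mul_one, PowerSeries.coeff_zero_eq_constantCoeff_apply]
    have := mul_dvd_mul (PowerSeries.X_dvd_iff.2 hg) (ih g)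
    simp only [h0] at this
    convert this using 1
    · rw [pow_succ']
    · rw [mul_sub, Finset.mul_sum]
      simp only [pow_succ', mul_left_comm (shift a PowerSeries.X)]
      ring

theorem evalU_serU_mul_serV (a : ℂ) (f h : PowerSeries ℂ) :
    evalU (shift a PowerSeries.X) (serU f * serV h) = shift a f * h := by
  rw [mul_comm, serV, evalU_C_mul (by simp [constantCoeff_shift]), evalU_serU, mul_comm]

/-- The factor `u - v - a` vanishes at `u = v + a`, that is, at `u⁻¹ = v⁻¹ (1 + a v⁻¹)⁻¹`. -/
theorem evalU_linFactor_mul (a : ℂ) (F : PowerSeries (PowerSeries ℂ)) :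
    evalU (shift a PowerSeries.X) (linFactor a * F) = 0 := by
  have hg : constantCoeff (shift a PowerSeries.X) = 0 := by simp [constantCoeff_shift]
  have h : linFactor a * F = PowerSeries.C PowerSeries.X * F - PowerSeries.X * F
      - PowerSeries.C (PowerSeries.C a * PowerSeries.X) * (PowerSeries.X * F) := by
    rw [linFactor, invUV, map_mul]
    simp only [Algebra.smul_def, PowerSeries.algebraMap_apply, Algebra.algebraMap_self,
      RingHom.id_apply]
    ring
  rw [h, evalU_sub, evalU_sub, evalU_C_mul hg, evalU_X_mul hg, evalU_C_mul hg, evalU_X_mul hg]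
  linear_combination -evalU (shift a PowerSeries.X) F * shift_X_mul a

end Evaluation

theorem card_filter_lt {m : ℕ} {j : Idx S n} (hj : j.1 = -n + m) (hj0 : j.1 ≤ 0) :
    (Finset.univ.filter fun p => p < j).card = m := by
  have : (Finset.univ.filter fun p => p < j).map
      (Function.Embedding.subtype _) = Finset.Ico (-(n : ℤ)) (-n + m) := by
    ext i
    simp only [Finset.mem_map, Finset.mem_filter, Finset.mem_univ, true_and,
      Function.Embedding.subtype_apply, Subtype.exists, ← Subtype.coe_lt_coe, exists_and_left,
      exists_prop, exists_eq_right_right, Finset.mem_Ico, hj]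
    rw [and_comm]
    refine and_congr_left fun h => ?_
    unfold indices
    split_ifs <;> simp <;> omega
  rw [← Finset.card_map (Function.Embedding.subtype _), this]
  simp

theorem IsHighestWeight.shift_mul_eq {lam : ℤ → PowerSeries ℂ} (h : IsHighestWeight S n lam)
    {m : ℕ} (hm : 1 ≤ m) (hm' : m ≤ numConditions S n) :
    shift (kappa S n - m) (lam (-n + m)) * lam (n - m) =
      shift (kappa S n - m) (lam (-n + m - 1)) * lam (n - m + 1) := by
  obtain ⟨φ, hφ⟩ := h
  obtain ⟨Z, W, hZW⟩ := hφ.exists_recursion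
  have hmem : -(n : ℤ) + m ∈ indices S n ∧ -(n : ℤ) + m - 1 ∈ indices S n ∧ m ≤ n := by
    unfold indices
    cases S <;> simp [numConditions] at * <;> omega
  set j : Idx S n := ⟨-n + m, hmem.1⟩
  set i : Idx S n := ⟨-n + m - 1, hmem.2.1⟩
  have hj : j.1 = -n + m := rfl
  have hi : i.1 = -n + m - 1 := rfl
  have hj0 : j.1 ≤ 0 := by omega
  have key := consecutive_of_recursion (D := linFactor (kappa S n)) (w := invUV)
    (a := fun i : Idx S n => serU (lam i.1) * serV (lam (-i.1))) (P := fun i => i.1 ≤ 0)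
    (fun p q hpq hq => (le_of_lt hpq : p.1 ≤ q.1).trans hq)
    (fun i hi => (hZW i hi).1) (fun i hi => (hZW i hi).2)
    (fun m => by rw [linFactor_add_natCast_mul]; exact linFactor_ne_zero _) (i := i) (j := j)
    (fun p => by rw [← Subtype.coe_lt_coe, ← Subtype.coe_le_coe, hj, hi]; omega) hj0
  rw [card_filter_lt hj hj0] at key
  set A := serU (lam j.1) * serV (lam (-j.1)) - serU (lam i.1) * serV (lam (-i.1)) with hA
  -- From `u-v-κ = (u-v-κ+m) - m`: everything divisible by `u-v-κ+m` is collected on the left,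
  -- leaving `m u⁻¹ v⁻¹ A`. Substituting `u = v+κ-m` kills the left side, so `A` vanishes there.
  have key' : linFactor (kappa S n - m) * (A - (Z j - Z i)) =
      PowerSeries.C (PowerSeries.C (m : ℂ) * PowerSeries.X) * (PowerSeries.X * A) := by
    rw [← linFactor_add_natCast_mul]
    have h : PowerSeries.C (PowerSeries.C (m : ℂ) * PowerSeries.X) * (PowerSeries.X * A) =
        (m : PowerSeries (PowerSeries ℂ)) * invUV * A := by
      rw [map_mul, map_natCast, map_natCast, invUV]
      ring
    rw [h]
    linear_combination -key
  have hg : constantCoeff (shift (kappa S n - m) PowerSeries.X) = 0 := by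
    simp [constantCoeff_shift]
  have hev := congrArg (evalU (shift (kappa S n - m) PowerSeries.X)) key'
  rw [evalU_linFactor_mul, evalU_C_mul hg, evalU_X_mul hg, eq_comm, mul_eq_zero, mul_eq_zero,
    mul_eq_zero, map_eq_zero_iff _ PowerSeries.C_injective] at hev
  have hg0 : shift (kappa S n - m) PowerSeries.X ≠ 0 := fun h0 => by
    have := shift_X_mul (kappa S n - m)
    rw [h0, zero_mul] at this
    exact PowerSeries.X_ne_zero this.symm
  have hm0 : (m : ℂ) ≠ 0 := by exact_mod_cast Nat.one_le_iff_ne_zero.1 hm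
  have := (hev.resolve_left (by simp [hm0, PowerSeries.X_ne_zero])).resolve_left hg0
  rw [hA, evalU_sub, evalU_serU_mul_serV, evalU_serU_mul_serV, sub_eq_zero, hj, hi] at this
  convert this using 3 <;> ring

end ExtYangian

/-! ### Sufficiency: approximation one coefficient at a time. -/

namespace ExtYangian
open ClassicalSeries
open PowerSeries (constantCoeff coeff)

variable {S : ClassicalSeries} {n : ℕ}

/-- The series `f` and `g` agree up to the coefficient of `u^{-K}`, where they differ by `d`. -/
def Deviates (K : ℕ) (d : ℂ) (f g : PowerSeries ℂ) : Prop :=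
  ∃ h, f = g + PowerSeries.X ^ K * h ∧ constantCoeff h = d

namespace Deviates

variable {K : ℕ} {d d' : ℂ} {f g f' g' : PowerSeries ℂ}

theorem coeff_eq (h : Deviates K d f g) : coeff K f = coeff K g + d := by
  obtain ⟨h, rfl, rfl⟩ := h
  rw [map_add, PowerSeries.coeff_X_pow_mul', if_pos le_rfl, Nat.sub_self,
    PowerSeries.coeff_zero_eq_constantCoeff_apply]

theorem coeff_eq_of_lt (h : Deviates K d f g) {r : ℕ} (hr : r < K) : coeff r f = coeff r g := by
  obtain ⟨h, rfl, -⟩ := h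
  rw [map_add, PowerSeries.coeff_X_pow_mul', if_neg (by omega), add_zero]

theorem of_coeff_eq (h : ∀ r < K, coeff r f = coeff r g) :
    Deviates K (coeff K f - coeff K g) f g := by
  obtain ⟨k, hk⟩ : PowerSeries.X ^ K ∣ f - g :=
    PowerSeries.X_pow_dvd_iff.2 fun r hr => by rw [map_sub, h r hr, sub_self]
  refine ⟨k, by rw [← hk]; ring, ?_⟩
  rw [← map_sub, hk, PowerSeries.coeff_X_pow_mul', if_pos le_rfl, Nat.sub_self,
    PowerSeries.coeff_zero_eq_constantCoeff_apply]

theorem refl (K : ℕ) (f : PowerSeries ℂ) : Deviates K 0 f f := ⟨0, by simp, by simp⟩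

theorem mul (h : Deviates K d f g) (h' : Deviates K d' f' g') (hf' : constantCoeff f' = 1)
    (hg : constantCoeff g = 1) : Deviates K (d + d') (f * f') (g * g') := by
  obtain ⟨k, hk, rfl⟩ := h
  obtain ⟨k', hk', rfl⟩ := h'
  refine ⟨k * f' + g * k', ?_, by simp [hf', hg]⟩
  linear_combination f' * hk + g * hk'

theorem inv (h : Deviates K d f 1) (hf : constantCoeff f = 1) : Deviates K (-d) f⁻¹ 1 := by
  obtain ⟨k, hk, rfl⟩ := h
  refine ⟨-k * f⁻¹, ?_, by simp [hf]⟩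
  have := PowerSeries.mul_inv_cancel f (by simp [hf])
  linear_combination this - f⁻¹ * hk

theorem shift (a : ℂ) (h : Deviates K d f g) :
    Deviates K d (ExtYangian.shift a f) (ExtYangian.shift a g) := by
  obtain ⟨k, rfl, rfl⟩ := h
  have hpow : ∀ K, ExtYangian.shift a (PowerSeries.X ^ K) =
      PowerSeries.X ^ K * ((1 + PowerSeries.C a * PowerSeries.X)⁻¹) ^ K := by
    intro K
    rw [← mul_pow, ← shift_X]
    exact PowerSeries.subst_pow (hasSubst_shift a) _ _
  refine ⟨((1 + PowerSeries.C a * PowerSeries.X)⁻¹) ^ K * ExtYangian.shift a k, ?_, ?_⟩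
  · rw [shift_add, shift_mul, hpow, mul_assoc]
  · simp [constantCoeff_shift]

theorem constantCoeff_eq (h : Deviates K d f g) (hK : 0 < K) :
    constantCoeff f = constantCoeff g := by
  simpa using h.coeff_eq_of_lt hK

end Deviates

theorem deviates_one_add (K : ℕ) (b : ℂ) :
    Deviates K b (1 + PowerSeries.C b * PowerSeries.X ^ K) 1 :=
  ⟨PowerSeries.C b, by rw [mul_comm], by simp⟩

/-- To leading order, the tuple of `f = 1 + b u^{-K}` adds `b` at the `k` smallest labels and `-b`
at the `k` largest, since the shift does not affect the leading term. Taking `b = x (t+1) - x t`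
with `k = n - t`, the contributions at a label `i` telescope to `±x |i|`. -/
theorem exists_isHighestWeight_antisymmetric (S : ClassicalSeries) (n : ℕ) {K : ℕ} (hK : 0 < K)
    (x : ℕ → ℂ) (hx : x 0 = 0) : ∃ mu, IsHighestWeight S n mu ∧
      ∀ i ∈ indices S n, Deviates K (if 0 < i then -x i.natAbs else x i.natAbs) (mu i) 1 := by
  have key : ∀ T ≤ n, ∃ mu, IsHighestWeight S n mu ∧ ∀ i, Deviates K
      (∑ t ∈ Finset.range T, if (t : ℤ) < i then -(x (t + 1) - x t) else
        if (t : ℤ) < -i then x (t + 1) - x t else 0) (mu i) 1 := by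
    intro T
    induction T with
    | zero =>
      exact fun _ => ⟨fun _ => 1, isHighestWeight_scalar S n 1 (by simp), fun i => Deviates.refl K 1⟩
    | succ T ih =>
      intro hT
      obtain ⟨mu, hmu, h⟩ := ih (by omega)
      set b := x (T + 1) - x T
      have hb := isHighestWeight_dualTuple S (Nat.sub_le n T) (1 + Polynomial.C b * Polynomial.X ^ K)
        (by simp [hK.ne])
      have hcoe : ((1 + Polynomial.C b * Polynomial.X ^ K : Polynomial ℂ) : PowerSeries ℂ) =
        1 + PowerSeries.C b * PowerSeries.X ^ K := by simp
      rw [hcoe] at hb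
      refine ⟨_, hmu.mul hb, fun i => ?_⟩
      rw [Finset.sum_range_succ, Pi.mul_apply]
      have hc : constantCoeff (1 + PowerSeries.C b * PowerSeries.X ^ K) = 1 := by
        simp [hK.ne']
      have hd : Deviates K (if (T : ℤ) < i then -b else if (T : ℤ) < -i then b else 0)
          (dualTuple S n (n - T) (1 + PowerSeries.C b * PowerSeries.X ^ K) i) 1 := by
        rw [dualTuple, outerTuple, Nat.cast_sub (by omega), sub_sub_cancel]
        split_ifs
        · refine Deviates.inv ?_ (by rw [constantCoeff_shift, hc])
          have := (deviates_one_add K b).shift (kappa S n - (n - T : ℕ))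
          rwa [shift_one] at this
        · exact deviates_one_add K b
        · exact Deviates.refl K 1
      have := (h i).mul hd (by rw [hd.constantCoeff_eq hK, map_one]) (map_one _)
      rwa [mul_one] at this
  obtain ⟨mu, hmu, h⟩ := key n le_rfl
  refine ⟨mu, hmu, fun i hi => ?_⟩
  convert h i using 1
  have habs : i.natAbs ≤ n := by
    unfold indices at hi
    split_ifs at hi <;> simp at hi <;> omega
  have hsum : ∑ t ∈ Finset.range n, (if t < i.natAbs then x (t + 1) - x t else 0) = x i.natAbs := by
    rw [← Finset.sum_filter, ← sub_zero (x i.natAbs), ← hx, ← Finset.sum_range_sub]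
    congr 1
    ext t
    simp only [Finset.mem_filter, Finset.mem_range]
    omega
  rw [← hsum]
  split_ifs with h0
  · rw [← Finset.sum_neg_distrib]
    refine Finset.sum_congr rfl fun t _ => ?_
    split_ifs <;> first | rfl | (exfalso; omega) | simp
  · refine Finset.sum_congr rfl fun t _ => ?_
    split_ifs <;> first | rfl | (exfalso; omega)

/-- If `μ` agrees with `λ` below order `K`, both satisfy the same multiplicative conditions, `μ`
because they are necessary. Comparison at order `K` shows that `δ i + δ (-i)` does not depend on
`i`, which is just what the available corrections can repair. -/
theorem isHighestWeight_of_shift_mul_eq {lam : ℤ → PowerSeries ℂ}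
    (hlam : ∀ i ∈ indices S n, constantCoeff (lam i) = 1)
    (h : ∀ m : ℕ, 1 ≤ m → m ≤ numConditions S n →
      shift (kappa S n - m) (lam (-n + m)) * lam (n - m) =
        shift (kappa S n - m) (lam (-n + m - 1)) * lam (n - m + 1)) :
    IsHighestWeight S n lam := by
  refine IsHighestWeight.of_approx fun R => ?_
  induction R with
  | zero =>
    refine ⟨fun _ => 1, isHighestWeight_scalar S n 1 (by simp), fun i hi r hr => ?_⟩
    obtain rfl : r = 0 := by omega
    simp [hlam i hi]
  | succ R ih =>
    obtain ⟨mu, hmu, hR⟩ := ih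
    set K := R + 1
    have hK : 0 < K := R.succ_pos
    set δ : ℤ → ℂ := fun i => coeff K (lam i) - coeff K (mu i)
    have hδ : ∀ i ∈ indices S n, Deviates K (δ i) (lam i) (mu i) := fun i hi =>
      Deviates.of_coeff_eq fun r hr => (hR i hi r (by omega)).symm
    have hmu1 : ∀ i ∈ indices S n, constantCoeff (mu i) = 1 := fun i hi => by
      rw [← (hδ i hi).constantCoeff_eq hK, hlam i hi]
    have hprod : ∀ i ∈ indices S n, ∀ j ∈ indices S n, ∀ a,
        Deviates K (δ i + δ j) (shift a (lam i) * lam j) (shift a (mu i) * mu j) :=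
      fun i hi j hj a => ((hδ i hi).shift a).mul (hδ j hj) (hlam j hj)
        (by rw [constantCoeff_shift, hmu1 i hi])
    have hsum : ∀ m : ℕ, m ≤ numConditions S n →
        δ (-n + m) + δ (n - m) = δ (-n) + δ n := by
      intro m
      induction m with
      | zero => simp
      | succ m ih =>
        intro hm
        rw [← ih (by omega)]
        have hmem : -(n : ℤ) + m ∈ indices S n ∧ -(n : ℤ) + (m + 1 : ℕ) ∈ indices S n := by
          unfold indices
          cases S <;> simp [numConditions] at * <;> omega
        have h1 := hprod _ hmem.2 _ (neg_mem_indices hmem.2) (kappa S n - (m + 1 : ℕ))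
        have h2 := hprod _ hmem.1 _ (neg_mem_indices hmem.1) (kappa S n - (m + 1 : ℕ))
        have e1 := h (m + 1) (by omega) hm
        have e2 := hmu.shift_mul_eq (Nat.le_add_left 1 m) hm
        rw [show -(n : ℤ) + (m + 1 : ℕ) - 1 = -n + m by push_cast; ring,
          show (n : ℤ) - (m + 1 : ℕ) + 1 = -(-n + m) by push_cast; ring,
          show (n : ℤ) - (m + 1 : ℕ) = -(-n + (m + 1 : ℕ)) by push_cast; ring] at e1 e2
        have c1 := h1.coeff_eq
        have c2 := h2.coeff_eq
        rw [e1, e2, c2, add_right_inj] at c1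
        rw [show (n : ℤ) - (m + 1 : ℕ) = -(-n + (m + 1 : ℕ)) by push_cast; ring,
          show (n : ℤ) - m = -(-n + m) by ring]
        exact c1.symm
    set e : ℂ := (δ (-n) + δ n) / 2 with he
    have hpair : ∀ i ∈ indices S n, δ i + δ (-i) = 2 * e := by
      intro i hi
      -- The conditions link all pairs `{i, -i}`: for `o_{2n+1}` the chain reaches the label `0` (`m
      -- = n`), otherwise it ends at `±1` (`m = n - 1`).
      obtain ⟨m, hm, h | h⟩ : ∃ m : ℕ, m ≤ numConditions S n ∧ (i = -n + m ∨ i = n - m) := by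
        refine ⟨n - i.natAbs, ?_, ?_⟩ <;> unfold indices at hi <;> cases S <;>
          simp [numConditions] at * <;> omega
      · rw [h, show -(-(n : ℤ) + m) = n - m by ring, hsum m hm]
        ring
      · rw [h, show -((n : ℤ) - m) = -n + m by ring, add_comm, hsum m hm]
        ring
    obtain ⟨nu, hnu, hν⟩ := exists_isHighestWeight_antisymmetric S n hK
      (fun a => if a = 0 then 0 else δ (-a) - e) (by simp)
    have hs := isHighestWeight_scalar S n (1 + PowerSeries.C e * PowerSeries.X ^ K)
      (by simp [hK.ne'])
    refine ⟨_, (hmu.mul hs).mul hnu, fun i hi r hr => ?_⟩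
    have hd := ((Deviates.refl K (mu i)).mul (deviates_one_add K e) (by simp [hK.ne'])
      (hmu1 i hi)).mul (hν i hi) (by rw [(hν i hi).constantCoeff_eq hK, map_one])
      (by simp [hmu1 i hi])
    rw [mul_one, mul_one] at hd
    -- At the label `0` the odd correction is zero, and `2 δ 0 = 2 e` makes the scalar correction
    -- `e` suffice.
    have hval : (0 + e + if 0 < i then -(if i.natAbs = 0 then 0 else δ (-i.natAbs) - e) else
        if i.natAbs = 0 then 0 else δ (-i.natAbs) - e) = δ i := by
      have := hpair i hi
      rcases lt_trichotomy i 0 with h0 | h0 | h0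
      · rw [if_neg (by omega), if_neg (by omega), show -(i.natAbs : ℤ) = i by omega]
        ring
      · rw [if_neg (by omega), if_pos (by omega)]
        subst h0
        rw [neg_zero] at this
        linear_combination -this / 2
      · rw [if_pos h0, if_neg (by omega), show -(i.natAbs : ℤ) = -i by omega]
        linear_combination -this
    rw [hval] at hd
    rcases Nat.lt_or_ge r K with hrK | hrK
    · exact (hd.coeff_eq_of_lt hrK).trans ((hδ i hi).coeff_eq_of_lt hrK).symm
    · obtain rfl : r = K := le_antisymm hr hrK
      exact hd.coeff_eq.trans (hδ i hi).coeff_eq.symm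

end ExtYangian

theorem proposition5p14 (S : ExtYangian.ClassicalSeries) (n : ℕ) (hn : 1 ≤ n)
    (hD : S = ExtYangian.ClassicalSeries.D → 2 ≤ n)
    (lam : ℤ → PowerSeries ℂ)
    (hlam : ∀ i ∈ ExtYangian.indices S n, PowerSeries.constantCoeff (lam i) = 1) :
    Nontrivial (ExtYangian.Verma S n lam) ↔
      ∀ i : ℕ, 1 ≤ i → i ≤ ExtYangian.numConditions S n →
        ExtYangian.shift (ExtYangian.kappa S n - i) (lam (-(n : ℤ) + i - 1))
            * (ExtYangian.shift (ExtYangian.kappa S n - i) (lam (-(n : ℤ) + i)))⁻¹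
          = lam ((n : ℤ) - i) * (lam ((n : ℤ) - i + 1))⁻¹ := by
  -- The denominators have constant term `1`, so the quotients can be cleared; otherwise the inverse
  -- of a power series would be `0` by convention.
  have key : ∀ m : ℕ, 1 ≤ m → m ≤ ExtYangian.numConditions S n →
      (ExtYangian.shift (ExtYangian.kappa S n - m) (lam (-(n : ℤ) + m - 1))
            * (ExtYangian.shift (ExtYangian.kappa S n - m) (lam (-(n : ℤ) + m)))⁻¹
          = lam ((n : ℤ) - m) * (lam ((n : ℤ) - m + 1))⁻¹ ↔
        ExtYangian.shift (ExtYangian.kappa S n - m) (lam (-n + m)) * lam (n - m) =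
          ExtYangian.shift (ExtYangian.kappa S n - m) (lam (-n + m - 1)) * lam (n - m + 1)) := by
    intro m hm hm'
    have hmem : -(n : ℤ) + m ∈ ExtYangian.indices S n ∧
        (n : ℤ) - m + 1 ∈ ExtYangian.indices S n := by
      unfold ExtYangian.indices
      cases S <;> simp [ExtYangian.numConditions] at * <;> omega
    have h1 : PowerSeries.constantCoeff (ExtYangian.shift (ExtYangian.kappa S n - m)
        (lam (-(n : ℤ) + m))) ≠ 0 := by
      rw [ExtYangian.constantCoeff_shift, hlam _ hmem.1]; exact one_ne_zero
    have h2 : PowerSeries.constantCoeff (lam ((n : ℤ) - m + 1)) ≠ 0 := by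
      rw [hlam _ hmem.2]; exact one_ne_zero
    rw [PowerSeries.eq_mul_inv_iff_mul_eq h2, mul_right_comm, eq_comm,
      PowerSeries.eq_mul_inv_iff_mul_eq h1, mul_comm (lam _)]
  rw [← ExtYangian.isHighestWeight_iff]
  constructor
  · exact fun h m hm hm' => (key m hm hm').2 (h.shift_mul_eq hm hm')
  · exact fun h => ExtYangian.isHighestWeight_of_shift_mul_eq hlam
      fun m hm hm' => (key m hm hm').1 (h m hm hm')
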